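/- **Setting.** Let $n\ge 1$ agents communicate over directed graphs $\mathcal G_R,\mathcal G_C$ on $\{1,\dots,n\}$ (an edge $(j,i)$ means that $i$ receives from $j$) with mixing matrices $R,C\in\mathbb R^{n\times n}$ such that: $R$ is row-stochastic and $C$ is column-stochastic; $R_{ij}>0$ iff $(j,i)\in\mathcal E_R$ or $i=j$, and $C_{ij}>0$ iff $(j,i)\in\mathcal E_C$ or $i=j$; and $\mathcal G_R$ and $\mathcal G_{C^\top}$ (the reversal of $\mathcal G_C$) have spanning trees with a common root. Let $\pi_R,\pi_C$ be the probability vectors with $\pi_R^\top R=\pi_R^\top$, $C\pi_C=\pi_C$, and $c_\pi=n\,\pi_R^\top\pi_C$. Let $f_1,\dots,f_n:\mathbb R^d\to\mathbb R$ be differentiable and bounded below with $L$-Lipschitz gradients, $F=\frac1n\sum_i f_i$, $F^*=\inf F$. Agent $i$ has a stochastic gradient oracle $g_i(x;\xi)$, $\xi\sim\mathcal D_i$, with $\mathbb E\,g_i(x;\xi)=\nabla f_i(x)$ and $\mathbb E\|g_i(x;\xi)-\nabla f_i(x)\|^2\le\sigma^2$ for all $x$; the samples $\xi_{i,k}\sim\mathcal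 D_i$ are independent over all $i$ and $k$. SMTPP with step size $\eta$ and momentum coefficient $\lambda$ starts from $x_{i,0}=x_0$, $m_{i,0}=v_{i,0}=0$ and iterates $$x_{i,k+1}=\sum_j R_{ij}(x_{j,k}-\eta v_{j,k}),\quad m_{i,k+1}=(1-\lambda)m_{i,k}+\lambda g_i(x_{i,k+1};\xi_{i,k+1}),\quad v_{i,k+1}=\sum_j C_{ij}v_{j,k}+m_{i,k+1}-m_{i,k}.$$ Let $X_k,M_k,V_k$ be the matrices with rows $x_{i,k},m_{i,k},v_{i,k}$; $\bar x_k=\pi_R^\top X_k$; $\bar m_k=\frac1n\sum_i m_{i,k}$ with $\bar m_{-1}=0$; and $\tilde z_k=\bar x_k-\frac{\eta c_\pi(1-\lambda)}{\lambda}\bar m_{k-1}$. For invertible $S_R,S_C\in\mathbb R^{n\times n}$ and $p\in\mathbb R^4$ with positive entries, the Lyapunov function is $$\mathcal V_k=\mathbb E[F(\tilde z_k)-F^*]+p_1\mathbb E\|S_R(X_k-\mathbf 1\pi_R^\top X_k)\|_F^2+p_2\mathbb E\|S_C(V_k-\pi_C\mathbf 1^\top V_k)\|_F^2+p_3\mathbb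 E\sum_i\|m_{i,k}-\nabla f_i(x_{i,k})\|^2+p_4\mathbb E\|\bar m_{k-1}\|^2.$$ **Corollary.** Let $a_1,a_2,b_1,b_2,\kappa>0$. There are $\lambda_{\max}\in(0,1)$ and $K>0$, depending only on the network ($R$, $C$, hence $n$), on $L$ and on $a_1,a_2,b_1,b_2,\kappa$, such that for every dimension, objective, oracle, variance bound $\sigma^2$ and starting point as above the following holds. 1. Let $T\ge1$, $a_1(n/T)^{1/4}\le\lambda\le a_2(n/T)^{1/4}$, $b_1\lambda^2\le\eta\le b_2\lambda^2$ and $\lambda\le\lambda_{\max}$. Then $b_1a_1^2\sqrt{n/T}\le\eta\le b_2a_2^2\sqrt{n/T}$, every $\|\nabla F(\bar x_k)\|^2$ is integrable, and for all invertible $S_R,S_C$ and all $p$ with positive entries and $p_3\ge\kappa\eta$, $$\frac1T\sum_{k=0}^{T-1}\mathbb E\|\nabla F(\bar x_k)\|^2\le K\,\frac{\mathcal V_0}{\sqrt{nT}}+K\,\sigma^2\sqrt{\frac nT},$$ where $\mathcal V_T\ge0$ and $\mathcal V_0=F(x_0)-F^*+p_3\sum_i\|\nabla f_i(x_0)\|^2$.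 2. If $\lambda_T,\eta_T$ satisfy $a_1(n/T)^{1/4}\le\lambda_T\le a_2(n/T)^{1/4}$ and $b_1\lambda_T^2\le\eta_T\le b_2\lambda_T^2$ for all large $T$, then $\frac1T\sum_{k=0}^{T-1}\mathbb E\|\nabla F(\bar x_k)\|^2\to0$ as $T\to\infty$, where for each $T$ the iterates are those of SMTPP run with $\lambda=\lambda_T$, $\eta=\eta_T$. -/

import Mathlib

open MeasureTheory ProbabilityTheory Filter Topology
open scoped Matrix

noncomputable section

namespace SMTPP

/-- The parameter space `ℝ^d` with the Euclidean norm. -/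
abbrev Vec (d : ℕ) := EuclideanSpace ℝ (Fin d)

/-! ### The network -/

/-- The digraph with all edges reversed. If `G` is the graph of the weight matrix `C`, this is the
graph of `Cᵀ`. -/
def reverse {V : Type*} (G : Digraph V) : Digraph V where
  Adj j i := G.Adj i j

/-- `T` is a spanning tree of `G` with root `r`: a subgraph with edges directed away from `r`, in
which every vertex but the root has exactly one parent and every vertex is reached from `r`. -/
structure IsSpanningTree {V : Type*} (G T : Digraph V) (r : V) : Prop where
  subgraph : ∀ j i, T.Adj j i → G.Adj j i
  root : ∀ j, ¬ T.Adj j r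
  parent : ∀ i, i ≠ r → ∃! j, T.Adj j i
  reach : ∀ i, Relation.ReflTransGen T.Adj r i

/-- The assumption on the pull graph `GR` and the push graph `GC` (an edge `Adj j i` means that `i`
receives from `j`) and on the mixing matrices `R`, `C`. -/
structure NetworkAssumption {n : ℕ} (GR GC : Digraph (Fin n))
    (R C : Matrix (Fin n) (Fin n) ℝ) : Prop where
  common_root : ∃ (r : Fin n) (TR TC : Digraph (Fin n)),
    IsSpanningTree GR TR r ∧ IsSpanningTree (reverse GC) TC r
  row_stochastic : R ∈ Matrix.rowStochastic ℝ (Fin n)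
  col_stochastic : C ∈ Matrix.colStochastic ℝ (Fin n)
  R_pos_iff : ∀ i j, 0 < R i j ↔ GR.Adj j i ∨ i = j
  C_pos_iff : ∀ i j, 0 < C i j ↔ GC.Adj j i ∨ i = j

/-- `π` is a probability vector with `πᵀ R = πᵀ`. -/
def IsLeftStationary {n : ℕ} (R : Matrix (Fin n) (Fin n) ℝ) (π : Fin n → ℝ) : Prop :=
  π ∈ stdSimplex ℝ (Fin n) ∧ π ᵥ* R = π

/-- `π` is a probability vector with `C π = π`. -/
def IsRightStationary {n : ℕ} (C : Matrix (Fin n) (Fin n) ℝ) (π : Fin n → ℝ) : Prop :=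
  π ∈ stdSimplex ℝ (Fin n) ∧ C *ᵥ π = π

/-- The topology constant `c_π = n π_Rᵀ π_C`. -/
def cPi {n : ℕ} (πR πC : Fin n → ℝ) : ℝ := n * (πR ⬝ᵥ πC)

/-! ### The objective and the stochastic oracle -/

/-- The global objective `F = (1/n) ∑ f_i`. -/
def objective {n d : ℕ} (f : Fin n → Vec d → ℝ) (x : Vec d) : ℝ := (1 / (n : ℝ)) * ∑ i, f i x

/-- The optimal value `F^* = inf F`. -/
def optValue {n d : ℕ} (f : Fin n → Vec d → ℝ) : ℝ := ⨅ x, objective f x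

/-- Every `f_i` is differentiable, bounded from below and has an `L`-Lipschitz gradient. -/
structure ObjectiveAssumption {n d : ℕ} (f : Fin n → Vec d → ℝ) (L : ℝ) : Prop where
  differentiable : ∀ i, Differentiable ℝ (f i)
  bddBelow : ∀ i, BddBelow (Set.range (f i))
  lipschitz : ∀ i x y, ‖gradient (f i) x - gradient (f i) y‖ ≤ L * ‖x - y‖

/-- The stochastic gradients `g_i(x; ξ)`, `ξ ∼ D_i`, are unbiased with variance at most `σ²`. -/
structure OracleAssumption {n d : ℕ} {Ξ : Type*} [MeasurableSpace Ξ] (f : Fin n → Vec d → ℝ)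
    (D : Fin n → Measure Ξ) (g : Fin n → Vec d → Ξ → Vec d) (σ : ℝ) : Prop where
  measurable : ∀ i, Measurable (Function.uncurry (g i))
  memLp : ∀ i x, MemLp (g i x) 2 (D i)
  unbiased : ∀ i x, ∫ s, g i x s ∂(D i) = gradient (f i) x
  variance_le : ∀ i x, ∫ s, ‖g i x s - gradient (f i) x‖ ^ 2 ∂(D i) ≤ σ ^ 2

/-- The samples `ξ_{i,k}` of agent `i` at iteration `k` are independent over all agents and
iterations, and `ξ_{i,k} ∼ D_i`. -/
structure SamplingAssumption {n : ℕ} {Ω Ξ : Type*} [MeasurableSpace Ω] [MeasurableSpace Ξ]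
    (μ : Measure Ω) (D : Fin n → Measure Ξ) (ξ : Fin n → ℕ → Ω → Ξ) : Prop where
  measurable : ∀ i k, Measurable (ξ i k)
  law : ∀ i k, μ.map (ξ i k) = D i
  indep : iIndepFun (fun q : Fin n × ℕ => ξ q.1 q.2) μ

/-! ### The algorithm -/

/-- Models `x_i`, momenta `m_i` and trackers `v_i` of all agents (the rows of `X`, `M`, `V`). -/
structure State (n d : ℕ) where
  x : Fin n → Vec d
  m : Fin n → Vec d
  v : Fin n → Vec d

/-- The data of a run of the algorithm. -/
structure Setup (n d : ℕ) (Ω Ξ : Type*) where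
  R : Matrix (Fin n) (Fin n) ℝ
  C : Matrix (Fin n) (Fin n) ℝ
  g : Fin n → Vec d → Ξ → Vec d
  ξ : Fin n → ℕ → Ω → Ξ
  x₀ : Vec d
  /-- the step size -/
  η : ℝ
  /-- the momentum coefficient -/
  lam : ℝ

variable {n d : ℕ} {Ω Ξ : Type*}

/-- The iterates: `x_{i,0} = x₀`, `m_{i,0} = v_{i,0} = 0`, and
`x_{i,k+1} = ∑ⱼ R_{ij} (x_{j,k} - η v_{j,k})`,
`m_{i,k+1} = (1 - λ) m_{i,k} + λ g_i(x_{i,k+1}; ξ_{i,k+1})`,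
`v_{i,k+1} = ∑ⱼ C_{ij} v_{j,k} + m_{i,k+1} - m_{i,k}`. -/
def Setup.iter (A : Setup n d Ω Ξ) (ω : Ω) : ℕ → State n d
  | 0 => { x := fun _ => A.x₀, m := fun _ => 0, v := fun _ => 0 }
  | k + 1 =>
    let s := A.iter ω k
    let x' : Fin n → Vec d := fun i => ∑ j, A.R i j • (s.x j - A.η • s.v j)
    let m' : Fin n → Vec d := fun i =>
      (1 - A.lam) • s.m i + A.lam • A.g i (x' i) (A.ξ i (k + 1) ω)
    { x := x'
      m := m'
      v := fun i => ∑ j, A.C i j • s.v j + (m' i - s.m i) }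

/-- The consensus average `x̄_k = π_Rᵀ X_k`. -/
def Setup.xbar (A : Setup n d Ω Ξ) (πR : Fin n → ℝ) (k : ℕ) (ω : Ω) : Vec d :=
  ∑ i, πR i • (A.iter ω k).x i

/-- The average momentum of the previous iteration, `m̄_{k-1}`, with `m̄_{-1} = 0`. -/
def Setup.mbarPrev (A : Setup n d Ω Ξ) (k : ℕ) (ω : Ω) : Vec d :=
  match k with
  | 0 => 0
  | k + 1 => (1 / (n : ℝ)) • ∑ i, (A.iter ω k).m i

/-- The averaged stationarity measure `(1/T) ∑_{k<T} E ‖∇F(x̄_k)‖²`. -/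
def Setup.avgGradSq [MeasurableSpace Ω] (A : Setup n d Ω Ξ) (μ : Measure Ω)
    (f : Fin n → Vec d → ℝ) (πR : Fin n → ℝ) (T : ℕ) : ℝ :=
  (1 / (T : ℝ)) * ∑ k ∈ Finset.range T, ∫ ω, ‖gradient (objective f) (A.xbar πR k ω)‖ ^ 2 ∂μ

/-! ### The Lyapunov function -/

/-- The virtual sequence `z̃_k = x̄_k - (η c_π (1 - λ) / λ) m̄_{k-1}`. -/
def Setup.ztilde (A : Setup n d Ω Ξ) (πR πC : Fin n → ℝ) (k : ℕ) (ω : Ω) : Vec d :=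
  A.xbar πR k ω - (A.η * cPi πR πC * (1 - A.lam) / A.lam) • A.mbarPrev k ω

/-- The square of the weighted norm `‖X‖_S`: the sum over the columns `x` of `X ∈ ℝ^{n × d}` of
`‖S x‖₂²`. -/
def weightedNormSq (S : Matrix (Fin n) (Fin n) ℝ) (X : Fin n → Vec d) : ℝ :=
  ∑ c : Fin d, ‖WithLp.toLp 2 (S *ᵥ fun i => X i c)‖ ^ 2

/-- The error vector `e_k = (E_x, E_v, E_m, E_M)`: consensus error `E ‖X_k - 1 π_Rᵀ X_k‖_R²`,
tracking error `E ‖V_k - π_C 1ᵀ V_k‖_C²`, momentum error `E ‖M_k - ∇F(X_k)‖_F²`, and momentum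
energy `E ‖m̄_{k-1}‖²`. -/
def Setup.errorVec [MeasurableSpace Ω] (A : Setup n d Ω Ξ) (μ : Measure Ω)
    (f : Fin n → Vec d → ℝ) (πR πC : Fin n → ℝ) (SR SC : Matrix (Fin n) (Fin n) ℝ) (k : ℕ) :
    Fin 4 → ℝ :=
  ![∫ ω, weightedNormSq SR (fun i => (A.iter ω k).x i - ∑ j, πR j • (A.iter ω k).x j) ∂μ,
    ∫ ω, weightedNormSq SC (fun i => (A.iter ω k).v i - πC i • ∑ j, (A.iter ω k).v j) ∂μ,
    ∫ ω, ∑ i, ‖(A.iter ω k).m i - gradient (f i) ((A.iter ω k).x i)‖ ^ 2 ∂μ,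
    ∫ ω, ‖A.mbarPrev k ω‖ ^ 2 ∂μ]

/-- The Lyapunov function `𝒱_k = E[F(z̃_k) - F^*] + pᵀ e_k` with weight vector `p`. -/
def Setup.lyapunov [MeasurableSpace Ω] (A : Setup n d Ω Ξ) (μ : Measure Ω)
    (f : Fin n → Vec d → ℝ) (πR πC : Fin n → ℝ) (SR SC : Matrix (Fin n) (Fin n) ℝ)
    (p : Fin 4 → ℝ) (k : ℕ) : ℝ :=
  ∫ ω, (objective f (A.ztilde πR πC k ω) - optValue f) ∂μ
    + p ⬝ᵥ A.errorVec μ f πR πC SR SC k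

/-- The coupling `λ = Θ((n/T)^{1/4})`, `η = Θ(λ²)`, with explicit constants. -/
def Coupled (n T : ℕ) (a₁ a₂ b₁ b₂ lam η : ℝ) : Prop :=
  a₁ * ((n : ℝ) / T) ^ (1 / 4 : ℝ) ≤ lam ∧ lam ≤ a₂ * ((n : ℝ) / T) ^ (1 / 4 : ℝ) ∧
    b₁ * lam ^ 2 ≤ η ∧ η ≤ b₂ * lam ^ 2

end SMTPP

end

open SMTPP

/-! The argument is pathwise until the last step. Along one sample path the correction in
`virtualSeq` makes the momentum telescope: $\tilde z_{k+1}=\tilde z_k-\eta(c_\pi\bar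
g_k+\pi_R^\top(V_k-\pi_C\mathbf 1^\top V_k))$, with $\bar g_k$ the averaged noisy gradient
(`virtualSeq_succ`). So $\tilde z$ performs plain stochastic gradient steps of size $\eta c_\pi$ on
$F$, up to a residual made of consensus error, momentum correction and tracking error. Here
$c_\pi>0$ because the common root has positive mass under both $\pi_R$ and $\pi_C$ (`cPi_pos`).
Smoothness then bounds $\sum\|\nabla F(\tilde z_k)\|^2$ by $(F(x_0)-F^*)/(c_\pi\eta)$, a cross term
with the noise, and the squared errors (`sum_descent`).

The errors are controlled by square sums. By Doeblin's argument the powers of $R-\mathbf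
1\pi_R^\top$ and $C-\pi_C\mathbf 1^\top$ tend to zero, so consensus and tracking errors are square
summable against their inputs $\eta v_k$ and $m_{k+1}-m_k$ (`exists_sum_sq_le`). The momentum error
contracts at rate $1-\lambda/2$. With $\eta\le b\lambda^2$ these estimates form a cyclic system in
which each feedback loop gains a factor $\lambda^2$. For small $\lambda$ it closes
(`gradient_sum_le_of_coupled_errors`). The momentum error itself contains the noise without any
gain, but it reaches the gradients only through terms carrying $\lambda^2$, so the noise finally
counts as $\lambda^2\sum\|e_{k+1}\|^2$ (`exists_pathwise_gradient_bound`).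

Probability enters only through two facts: the cross term has mean zero for $k\ge1$, since $\tilde
z_k$ and $x_k$ depend only on samples before time $k$ (`integral_inner_noise`), and each noise
vector has second moment at most $\sigma^2$. Dividing by $T$ and inserting $\eta\gtrsim\sqrt{n/T}$,
$\lambda^2\lesssim\sqrt{n/T}$ gives the rate; the initial gradients are paid for by
$p_3\ge\kappa\eta$. Since $K$ may depend on $n$, the sup norm over agents is precise enough
throughout. -/

noncomputable section

namespace SMTPP

/-! ### Mixing matrices acting on families of vectors -/

section Mix

variable {ι E : Type*} [Fintype ι] [NormedAddCommGroup E] [NormedSpace ℝ E]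

/-- The action of a square matrix on a family of vectors. -/
def mix (A : Matrix ι ι ℝ) (X : ι → E) : ι → E := fun i => ∑ j, A i j • X j

lemma mix_add (A : Matrix ι ι ℝ) (X Y : ι → E) : mix A (X + Y) = mix A X + mix A Y := by
  ext1 i; simp [mix, Finset.sum_add_distrib]

lemma mix_sub (A : Matrix ι ι ℝ) (X Y : ι → E) : mix A (X - Y) = mix A X - mix A Y := by
  ext1 i; simp [mix, smul_sub, Finset.sum_sub_distrib]

lemma sub_mix (A B : Matrix ι ι ℝ) (X : ι → E) : mix (A - B) X = mix A X - mix B X := by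
  ext1 i; simp [mix, sub_smul, Finset.sum_sub_distrib]

lemma mix_mul (A B : Matrix ι ι ℝ) (X : ι → E) : mix (A * B) X = mix A (mix B X) := by
  ext1 i
  simp only [mix, Matrix.mul_apply, Finset.sum_smul, Finset.smul_sum, mul_smul]
  exact Finset.sum_comm

lemma one_mix [DecidableEq ι] (X : ι → E) : mix (1 : Matrix ι ι ℝ) X = X := by
  ext1 i; simp [mix, Matrix.one_apply]

lemma norm_mix_le {A : Matrix ι ι ℝ} {c : ℝ} (hc : 0 ≤ c) (hA : ∀ i, ∑ j, |A i j| ≤ c)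
    (X : ι → E) : ‖mix A X‖ ≤ c * ‖X‖ := by
  refine (pi_norm_le_iff_of_nonneg (by positivity)).2 fun i => ?_
  calc ‖∑ j, A i j • X j‖ ≤ ∑ j, |A i j| * ‖X‖ := by
        refine (norm_sum_le _ _).trans (Finset.sum_le_sum fun j _ => ?_)
        rw [norm_smul, Real.norm_eq_abs]
        gcongr
        exact norm_le_pi_norm X j
    _ = (∑ j, |A i j|) * ‖X‖ := by rw [Finset.sum_mul]
    _ ≤ c * ‖X‖ := by gcongr; exact hA i

lemma norm_mix_le_sum (A : Matrix ι ι ℝ) (X : ι → E) :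
    ‖mix A X‖ ≤ (∑ i, ∑ j, |A i j|) * ‖X‖ := by
  have h : ∀ i, 0 ≤ ∑ j, |A i j| := fun i => Finset.sum_nonneg fun j _ => abs_nonneg _
  exact norm_mix_le (Finset.sum_nonneg fun i _ => h i)
    (fun i => Finset.single_le_sum (fun i _ => h i) (Finset.mem_univ i)) X

end Mix

/-- A perturbed linear recursion whose matrix has a power of norm at most `1/2` is square
summable against its inputs. -/
lemma exists_sum_sq_le {ι : Type*} [Fintype ι] [DecidableEq ι] (B : Matrix ι ι ℝ)
    {q : ℕ} (hq : 0 < q) (hB : ∀ i, ∑ j, |(B ^ q) i j| ≤ 1 / 2) :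
    ∃ c : ℝ, 0 < c ∧ ∀ (d : ℕ) (Y W : ℕ → ι → Vec d), Y 0 = 0 →
      (∀ k, Y (k + 1) = mix B (Y k) + W k) →
      ∀ T, ∑ k ∈ Finset.range T, ‖Y k‖ ^ 2 ≤ c * ∑ k ∈ Finset.range T, ‖W k‖ ^ 2 := by
  set b : ℕ → ℝ := fun j => ∑ i, ∑ l, |(B ^ j) i l| with hb
  set c₀ : ℝ := 1 + ∑ j ∈ Finset.range q, b j with hc₀
  have hbpos : ∀ j, 0 ≤ b j := fun j => by positivity
  have hc₀1 : 1 ≤ c₀ := by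
    have := Finset.sum_nonneg (s := Finset.range q) fun j _ => hbpos j
    linarith
  have hc₀' : 0 < c₀ := by linarith
  set δ : ℝ := 1 / (2 * c₀) with hδ
  have hδ0 : 0 < δ := by positivity
  have hδ1 : δ ≤ 1 / 2 := by
    rw [hδ]; gcongr; linarith
  refine ⟨c₀ ^ 2 / δ ^ 2, by positivity, fun d Y W h0 hY T => ?_⟩
  -- An adapted norm: applying `B` shifts the sum by one index, so one step trades `‖y‖` for `‖B ^ q
  -- y‖ ≤ ‖y‖ / 2`. Since `N y ≤ c₀ * ‖y‖`, the loss `‖y‖ / 2` is at least `δ * N y`.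
  set N : (ι → Vec d) → ℝ := fun y => ∑ j ∈ Finset.range q, ‖mix (B ^ j) y‖ with hN
  have hNpos : ∀ y, 0 ≤ N y := fun y => by positivity
  have hNle : ∀ y, N y ≤ c₀ * ‖y‖ := fun y => by
    calc N y ≤ ∑ j ∈ Finset.range q, b j * ‖y‖ :=
          Finset.sum_le_sum fun j _ => norm_mix_le_sum _ _
      _ = (∑ j ∈ Finset.range q, b j) * ‖y‖ := by rw [Finset.sum_mul]
      _ ≤ c₀ * ‖y‖ := by gcongr; linarith
  have hleN : ∀ y, ‖y‖ ≤ N y := fun y => by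
    have := Finset.single_le_sum (f := fun j => ‖mix (B ^ j) y‖)
      (fun _ _ => norm_nonneg _) (Finset.mem_range.2 hq)
    simpa [one_mix] using this
  have hNadd : ∀ y z, N (y + z) ≤ N y + N z := fun y z => by
    rw [hN]; simp only [mix_add, ← Finset.sum_add_distrib]
    exact Finset.sum_le_sum fun j _ => norm_add_le _ _
  have hNB : ∀ y, N (mix B y) ≤ (1 - δ) * N y := fun y => by
    have e1 : N (mix B y) + ‖y‖ = N y + ‖mix (B ^ q) y‖ := by
      have h1 := Finset.sum_range_succ (fun j => ‖mix (B ^ j) y‖) q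
      have h2 := Finset.sum_range_succ' (fun j => ‖mix (B ^ j) y‖) q
      simp only [pow_succ, mix_mul, pow_zero, one_mix] at h2
      rw [hN]; linarith
    have e2 := norm_mix_le (by norm_num) hB y
    have e3 : δ * N y ≤ ‖y‖ / 2 := by
      calc δ * N y ≤ δ * (c₀ * ‖y‖) := by gcongr; exact hNle y
        _ = ‖y‖ / 2 := by rw [hδ]; field_simp
    linarith
  have hrec : ∀ k, N (Y (k + 1)) ^ 2 ≤ (1 - δ) * N (Y k) ^ 2 + c₀ ^ 2 / δ * ‖W k‖ ^ 2 := fun k => by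
    -- The input is written as `δ` times something so that the bound is a convex combination and
    -- squaring costs no cross term.
    have h1 : N (Y (k + 1)) ≤ (1 - δ) * N (Y k) + δ * (c₀ * ‖W k‖ / δ) := by
      rw [hY k, mul_div_cancel₀ _ hδ0.ne']
      exact (hNadd _ _).trans (add_le_add (hNB _) (hNle _))
    calc N (Y (k + 1)) ^ 2 ≤ ((1 - δ) * N (Y k) + δ * (c₀ * ‖W k‖ / δ)) ^ 2 :=
          pow_le_pow_left₀ (hNpos _) h1 2
      _ ≤ (1 - δ) * N (Y k) ^ 2 + δ * (c₀ * ‖W k‖ / δ) ^ 2 := by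
          have : 0 ≤ δ * (1 - δ) := mul_nonneg hδ0.le (by linarith)
          nlinarith [mul_nonneg this (sq_nonneg (N (Y k) - c₀ * ‖W k‖ / δ))]
      _ = _ := by field_simp
  have hsum : ∀ T, N (Y T) ^ 2 + δ * ∑ k ∈ Finset.range T, N (Y k) ^ 2
      ≤ c₀ ^ 2 / δ * ∑ k ∈ Finset.range T, ‖W k‖ ^ 2 := fun T => by
    induction T with
    | zero =>
      have : N 0 = 0 := le_antisymm (by simpa using hNle 0) (hNpos 0)
      simp [h0, this]
    | succ T ih => rw [Finset.sum_range_succ, Finset.sum_range_succ]; linarith [hrec T]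
  have h1 : δ * ∑ k ∈ Finset.range T, ‖Y k‖ ^ 2 ≤ δ * ∑ k ∈ Finset.range T, N (Y k) ^ 2 := by
    gcongr with k _
    exact hleN _
  have h2 := hsum T
  have h3 : δ * ∑ k ∈ Finset.range T, ‖Y k‖ ^ 2 ≤
      c₀ ^ 2 / δ * ∑ k ∈ Finset.range T, ‖W k‖ ^ 2 := by nlinarith [sq_nonneg (N (Y T))]
  rw [mul_comm, ← le_div_iff₀ hδ0] at h3
  refine h3.trans_eq ?_
  field_simp

/-! ### Convergence of the powers of a stochastic matrix -/

section Stochastic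

variable {ι : Type*} [Fintype ι] [DecidableEq ι]

/-- Paths from the root give positive entries of some power for each vertex separately; self-loops
keep them positive in all later powers, so one exponent serves all vertices. -/
lemma exists_pow_column_pos {R : Matrix ι ι ℝ} (hR : R ∈ Matrix.rowStochastic ℝ ι)
    (hdiag : ∀ i, 0 < R i i) {r : ι}
    (hreach : ∀ i, Relation.ReflTransGen (fun j i => 0 < R i j) r i) :
    ∃ m : ℕ, 0 < m ∧ ∃ ε : ℝ, 0 < ε ∧ ε ≤ 1 ∧ ∀ i, ε ≤ (R ^ m) i r := by
  have hnn : ∀ m i j, 0 ≤ (R ^ m) i j := fun m i j =>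
    Matrix.nonneg_of_mem_rowStochastic (pow_mem hR m)
  have hstep : ∀ m i j, 0 < R i j → 0 < (R ^ m) j r → 0 < (R ^ (m + 1)) i r := by
    intro m i j h1 h2
    rw [pow_succ', Matrix.mul_apply]
    exact Finset.sum_pos' (fun l _ => mul_nonneg (Matrix.nonneg_of_mem_rowStochastic hR) (hnn _ _ _))
      ⟨j, Finset.mem_univ j, mul_pos h1 h2⟩
  have hmono : ∀ i a b, a ≤ b → 0 < (R ^ a) i r → 0 < (R ^ b) i r := by
    intro i a b hab h
    induction b, hab using Nat.le_induction with
    | base => exact h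
    | succ b _ ih => exact hstep b i i (hdiag i) ih
  have hex : ∀ i, ∃ m, 0 < (R ^ m) i r := fun i => by
    induction hreach i with
    | refl => exact ⟨0, by simp⟩
    | tail _ h ih => obtain ⟨m, hm⟩ := ih; exact ⟨m + 1, hstep m _ _ h hm⟩
  choose M hM using hex
  set m := Finset.univ.sup M + 1
  have hpos : ∀ i, 0 < (R ^ m) i r := fun i =>
    hmono i (M i) m ((Finset.le_sup (Finset.mem_univ i)).trans (Nat.le_succ _)) (hM i)
  obtain ⟨i₀, -, hi₀⟩ := Finset.exists_min_image Finset.univ (fun i => (R ^ m) i r)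
    ⟨r, Finset.mem_univ r⟩
  exact ⟨m, Nat.succ_pos _, (R ^ m) i₀ r, hpos i₀,
    Matrix.le_one_of_mem_rowStochastic (pow_mem hR m), fun i => hi₀ i (Finset.mem_univ i)⟩

/-- Doeblin's contraction of the oscillation. -/
lemma mulVec_oscillation_le {Q : Matrix ι ι ℝ} (hQ : Q ∈ Matrix.rowStochastic ℝ ι) {r : ι}
    {ε : ℝ} (hε : ∀ i, ε ≤ Q i r) {y : ι → ℝ} {D : ℝ}
    (hy : ∃ a, ∀ i, a ≤ y i ∧ y i ≤ a + D) :
    ∃ a, ∀ i, a ≤ (Q *ᵥ y) i ∧ (Q *ᵥ y) i ≤ a + (1 - ε) * D := by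
  obtain ⟨a, ha⟩ := hy
  refine ⟨ε * y r + (1 - ε) * a, fun i => ?_⟩
  -- Every row of `Q` puts mass `ε` on `r`. That part contributes the same `ε * y r` to all
  -- coordinates; only the remaining mass `1 - ε` can spread them.
  set w : ι → ℝ := fun l => Q i l - if l = r then ε else 0 with hw
  have hw0 : ∀ l, 0 ≤ w l := fun l => by
    by_cases h : l = r
    · subst h; simpa [hw] using hε i
    · simpa [hw, h] using Matrix.nonneg_of_mem_rowStochastic hQ
  have hw1 : ∑ l, w l = 1 - ε := by
    simp [hw, Finset.sum_sub_distrib, Matrix.sum_row_of_mem_rowStochastic hQ i]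
  have e : (Q *ᵥ y) i = ε * y r + ∑ l, w l * y l := by
    simp [hw, Matrix.mulVec, dotProduct, sub_mul, Finset.sum_sub_distrib]
  have lo : (1 - ε) * a ≤ ∑ l, w l * y l := by
    rw [← hw1, Finset.sum_mul]
    exact Finset.sum_le_sum fun l _ => mul_le_mul_of_nonneg_left (ha l).1 (hw0 l)
  have hi : ∑ l, w l * y l ≤ (1 - ε) * (a + D) := by
    rw [← hw1, Finset.sum_mul]
    exact Finset.sum_le_sum fun l _ => mul_le_mul_of_nonneg_left (ha l).2 (hw0 l)
  constructor <;> rw [e] <;> linarith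

lemma dotProduct_mem_Icc {ι : Type*} [Fintype ι] {π y : ι → ℝ} (hπ : π ∈ stdSimplex ℝ ι) {a b : ℝ}
    (h : ∀ i, a ≤ y i ∧ y i ≤ b) : a ≤ π ⬝ᵥ y ∧ π ⬝ᵥ y ≤ b := by
  constructor
  · calc a = ∑ i, π i * a := by rw [← Finset.sum_mul, hπ.2, one_mul]
      _ ≤ _ := Finset.sum_le_sum fun i _ => mul_le_mul_of_nonneg_left (h i).1 (hπ.1 i)
  · calc _ ≤ ∑ i, π i * b :=
          Finset.sum_le_sum fun i _ => mul_le_mul_of_nonneg_left (h i).2 (hπ.1 i)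
      _ = b := by rw [← Finset.sum_mul, hπ.2, one_mul]

/-- The powers of `R - 1 πᵀ` become arbitrarily small. -/
lemma exists_pow_sub_stationary_le {R : Matrix ι ι ℝ} (hR : R ∈ Matrix.rowStochastic ℝ ι)
    (hdiag : ∀ i, 0 < R i i) {r : ι}
    (hreach : ∀ i, Relation.ReflTransGen (fun j i => 0 < R i j) r i)
    {π : ι → ℝ} (hπ : π ∈ stdSimplex ℝ ι) (hstat : π ᵥ* R = π) {δ : ℝ} (hδ : 0 < δ) :
    ∃ q : ℕ, 0 < q ∧ ∀ i j, |((R - Matrix.vecMulVec (1 : ι → ℝ) π) ^ q) i j| ≤ δ := by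
  obtain ⟨m, hm, ε, hε0, hε1, hε⟩ := exists_pow_column_pos hR hdiag hreach
  set P : Matrix ι ι ℝ := Matrix.vecMulVec (1 : ι → ℝ) π with hP
  have hRP : R * P = P := by
    rw [hP, Matrix.mul_vecMulVec, Matrix.one_vecMul_of_mem_rowStochastic hR]
  have hPR : P * R = P := by rw [hP, Matrix.vecMulVec_mul, hstat]
  have hPP : P * P = P := by
    rw [hP, Matrix.vecMulVec_mul_vecMulVec]
    have : π ⬝ᵥ (1 : ι → ℝ) = 1 := by simpa [dotProduct] using hπ.2
    rw [this, one_smul]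
  have hpowP : ∀ q, R ^ q * P = P := fun q => by
    induction q with
    | zero => simp
    | succ q ih => rw [pow_succ, mul_assoc, hRP, ih]
  -- As `P` is idempotent and absorbs `R` on both sides, all mixed terms collapse. This fails for
  -- the exponent `0`, hence the shift.
  have hpow : ∀ q, (R - P) ^ (q + 1) = R ^ (q + 1) - P := fun q => by
    induction q with
    | zero => simp
    | succ q ih =>
      rw [pow_succ, ih, sub_mul, mul_sub, mul_sub, hPR, hPP, hpowP, ← pow_succ]
      abel
  have hstat' : ∀ q, π ᵥ* R ^ q = π := fun q => by
    induction q with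
    | zero => simp
    | succ q ih => rw [pow_succ, ← Matrix.vecMul_vecMul, ih, hstat]
  have hosc : ∀ (j : ι) (k : ℕ), ∃ a, ∀ i, a ≤ (((R ^ m) ^ k) *ᵥ Pi.single j 1) i ∧
      (((R ^ m) ^ k) *ᵥ Pi.single j 1) i ≤ a + (1 - ε) ^ k := fun j k => by
    induction k with
    | zero =>
      refine ⟨0, fun i => ?_⟩
      by_cases h : i = j
      · subst h; simp
      · simp [h]
    | succ k ih =>
      rw [pow_succ' (R ^ m), ← Matrix.mulVec_mulVec, pow_succ' (1 - ε)]
      exact mulVec_oscillation_le (pow_mem hR m) hε ih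
  obtain ⟨k, hk⟩ := exists_pow_lt_of_lt_one hδ (show 1 - ε < 1 by linarith)
  have hk' : (1 - ε) ^ (k + 1) ≤ δ := by
    rw [pow_succ]
    exact (mul_le_of_le_one_right (pow_nonneg (by linarith) _) (by linarith)).trans hk.le
  refine ⟨m * (k + 1), by positivity, fun i j => ?_⟩
  obtain ⟨a, ha⟩ := hosc j (k + 1)
  -- The entry `π j` is the `π`-average of column `j` of the power, so it lies in the same short
  -- interval as the entries of that column.
  have h2 := dotProduct_mem_Icc hπ ha
  rw [← pow_mul, Matrix.dotProduct_mulVec, hstat'] at h2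
  obtain ⟨q, hq⟩ : ∃ q, m * (k + 1) = q + 1 :=
    ⟨m * (k + 1) - 1, (Nat.succ_pred_eq_of_pos (by positivity)).symm⟩
  have h1 := ha i
  rw [← pow_mul] at h1
  rw [hq, hpow, ← hq]
  simp only [Matrix.mulVec_single_one, Matrix.col_apply, dotProduct_single_one] at h1 h2
  simp only [Matrix.sub_apply, hP, Matrix.vecMulVec_apply, Pi.one_apply, one_mul]
  rw [abs_le]; constructor <;> linarith [h1.1, h1.2, h2.1, h2.2]

/-- Stationary mass moves against the edges, from a receiver to those it listens to. Some vertex has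
mass, and following the path back from it carries mass to the root. -/
lemma stationary_root_pos {R : Matrix ι ι ℝ} (hR : R ∈ Matrix.rowStochastic ℝ ι) {r : ι}
    (hreach : ∀ i, Relation.ReflTransGen (fun j i => 0 < R i j) r i)
    {π : ι → ℝ} (hπ : π ∈ stdSimplex ℝ ι) (hstat : π ᵥ* R = π) : 0 < π r := by
  have hstep : ∀ i j, 0 < R i j → 0 < π i → 0 < π j := fun i j h1 h2 => by
    rw [← hstat]
    exact Finset.sum_pos' (fun l _ => mul_nonneg (hπ.1 l) (Matrix.nonneg_of_mem_rowStochastic hR))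
      ⟨i, Finset.mem_univ i, mul_pos h2 h1⟩
  obtain ⟨i, hi⟩ : ∃ i, 0 < π i := by
    by_contra! h
    have := Finset.sum_nonpos fun i (_ : i ∈ Finset.univ) => h i
    rw [hπ.2] at this
    linarith
  have hr := hreach i
  clear hreach
  induction hr using Relation.ReflTransGen.head_induction_on with
  | refl => exact hi
  | head h _ ih => exact hstep _ _ h ih

end Stochastic

/-! ### Constants of the network -/

/-- Solutions of `Y (k + 1) = B Y k + W k` started at zero are square summable against `W`. -/
def IsStableWith {n : ℕ} (B : Matrix (Fin n) (Fin n) ℝ) (c : ℝ) : Prop :=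
  ∀ (d : ℕ) (Y W : ℕ → Fin n → Vec d), Y 0 = 0 → (∀ k, Y (k + 1) = mix B (Y k) + W k) →
    ∀ T, ∑ k ∈ Finset.range T, ‖Y k‖ ^ 2 ≤ c * ∑ k ∈ Finset.range T, ‖W k‖ ^ 2

section Network

variable {n : ℕ} {GR GC : Digraph (Fin n)} {R C : Matrix (Fin n) (Fin n) ℝ} {πR πC : Fin n → ℝ}

lemma NetworkAssumption.exists_root (h : NetworkAssumption GR GC R C) :
    ∃ r, (∀ i, Relation.ReflTransGen (fun j i => 0 < R i j) r i) ∧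
      ∀ i, Relation.ReflTransGen (fun j i => 0 < Cᵀ i j) r i := by
  obtain ⟨r, TR, TC, hR, hC⟩ := h.common_root
  refine ⟨r, fun i => Relation.ReflTransGen.mono (fun j i hji => ?_) _ _ (hR.reach i),
    fun i => Relation.ReflTransGen.mono (fun j i hji => ?_) _ _ (hC.reach i)⟩
  · exact (h.R_pos_iff i j).2 (Or.inl (hR.subgraph _ _ hji))
  · exact (h.C_pos_iff j i).2 (Or.inl (hC.subgraph _ _ hji))

lemma NetworkAssumption.transpose_rowStochastic (h : NetworkAssumption GR GC R C) :
    Cᵀ ∈ Matrix.rowStochastic ℝ (Fin n) :=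
  Matrix.transpose_mem_rowStochastic_iff_mem_colStochastic.2 h.col_stochastic

lemma IsRightStationary.vecMul_transpose (h : IsRightStationary C πC) : πC ᵥ* Cᵀ = πC := by
  rw [Matrix.vecMul_transpose]; exact h.2

/-- This is where the root has to be common to both graphs: a single index at which both stationary
vectors are positive makes their inner product positive. -/
lemma cPi_pos (h : NetworkAssumption GR GC R C) (hR : IsLeftStationary R πR)
    (hC : IsRightStationary C πC) : 0 < cPi πR πC := by
  obtain ⟨r, h1, h2⟩ := h.exists_root
  have hr := stationary_root_pos h.row_stochastic h1 hR.1 hR.2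
  have hc := stationary_root_pos h.transpose_rowStochastic h2 hC.1 hC.vecMul_transpose
  refine mul_pos (Nat.cast_pos.2 (Fin.pos r)) ?_
  exact Finset.sum_pos' (fun l _ => mul_nonneg (hR.1.1 l) (hC.1.1 l))
    ⟨r, Finset.mem_univ r, mul_pos hr hc⟩

lemma exists_isStableWith_of_small {B : Matrix (Fin n) (Fin n) ℝ}
    (h : ∀ δ : ℝ, 0 < δ → ∃ q : ℕ, 0 < q ∧ ∀ i j, |(B ^ q) i j| ≤ δ) :
    ∃ c, 0 < c ∧ IsStableWith B c := by
  obtain ⟨q, hq, hB⟩ := h (1 / (2 * (n + 1))) (by positivity)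
  refine exists_sum_sq_le B hq fun i => ?_
  calc ∑ j, |(B ^ q) i j| ≤ ∑ _j : Fin n, (1 / (2 * ((n : ℝ) + 1))) :=
        Finset.sum_le_sum fun j _ => hB i j
    _ = n / (n + 1) * (1 / 2) := by simp; field_simp
    _ ≤ 1 / 2 := by
        have : (n : ℝ) / (n + 1) ≤ 1 := by rw [div_le_one (by positivity)]; linarith
        linarith

lemma exists_isStableWith_row (h : NetworkAssumption GR GC R C) (hR : IsLeftStationary R πR) :
    ∃ c, 0 < c ∧ IsStableWith (R - Matrix.vecMulVec (1 : Fin n → ℝ) πR) c := by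
  obtain ⟨r, h1, -⟩ := h.exists_root
  exact exists_isStableWith_of_small fun δ hδ => exists_pow_sub_stationary_le h.row_stochastic
    (fun i => (h.R_pos_iff i i).2 (Or.inr rfl)) h1 hR.1 hR.2 hδ

lemma exists_isStableWith_col (h : NetworkAssumption GR GC R C) (hC : IsRightStationary C πC) :
    ∃ c, 0 < c ∧ IsStableWith (C - Matrix.vecMulVec πC (1 : Fin n → ℝ)) c := by
  obtain ⟨r, -, h2⟩ := h.exists_root
  refine exists_isStableWith_of_small fun δ hδ => ?_
  obtain ⟨q, hq, hB⟩ := exists_pow_sub_stationary_le h.transpose_rowStochastic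
    (fun i => (h.C_pos_iff i i).2 (Or.inr rfl)) h2 hC.1 hC.vecMul_transpose hδ
  refine ⟨q, hq, fun i j => ?_⟩
  have e : C - Matrix.vecMulVec πC (1 : Fin n → ℝ)
      = (Cᵀ - Matrix.vecMulVec (1 : Fin n → ℝ) πC)ᵀ := by
    rw [Matrix.transpose_sub, Matrix.transpose_vecMulVec, Matrix.transpose_transpose]
  rw [e, ← Matrix.transpose_pow]
  exact hB j i

end Network

/-! ### Averages -/

section Averages

variable {n : ℕ} {E : Type*} [NormedAddCommGroup E] [NormedSpace ℝ E]

/-- The uniform average of a family of vectors. -/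
def avg (X : Fin n → E) : E := (1 / (n : ℝ)) • ∑ i, X i

lemma avg_add (X Y : Fin n → E) : avg (X + Y) = avg X + avg Y := by
  simp [avg, Finset.sum_add_distrib]

lemma avg_sub (X Y : Fin n → E) : avg (X - Y) = avg X - avg Y := by
  simp [avg, Finset.sum_sub_distrib, smul_sub]

lemma avg_smul (c : ℝ) (X : Fin n → E) : avg (c • X) = c • avg X := by
  simp only [avg, Pi.smul_apply, ← Finset.smul_sum]; rw [smul_comm]

lemma avg_neg (X : Fin n → E) : avg (-X) = -avg X := by
  simp [avg]

lemma avg_zero : avg (0 : Fin n → E) = 0 := by simp [avg]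

lemma norm_weighted_sum_le {π : Fin n → ℝ} (hπ : π ∈ stdSimplex ℝ (Fin n)) (X : Fin n → E) :
    ‖∑ i, π i • X i‖ ≤ ‖X‖ := by
  calc ‖∑ i, π i • X i‖ ≤ ∑ i, π i * ‖X‖ := by
        refine (norm_sum_le _ _).trans (Finset.sum_le_sum fun j _ => ?_)
        rw [norm_smul, Real.norm_eq_abs, abs_of_nonneg (hπ.1 j)]
        exact mul_le_mul_of_nonneg_left (norm_le_pi_norm X j) (hπ.1 j)
    _ = ‖X‖ := by rw [← Finset.sum_mul, hπ.2, one_mul]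

lemma norm_avg_le (X : Fin n → E) : ‖avg X‖ ≤ ‖X‖ := by
  rcases Nat.eq_zero_or_pos n with rfl | hn
  · simp [avg]
  have hn' : (n : ℝ) ≠ 0 := by positivity
  have := norm_weighted_sum_le (π := fun _ : Fin n => 1 / (n : ℝ))
    ⟨fun _ => by positivity, by simp [hn']⟩ X
  rwa [← Finset.smul_sum] at this

lemma norm_mix_rowStochastic_le {R : Matrix (Fin n) (Fin n) ℝ}
    (hR : R ∈ Matrix.rowStochastic ℝ (Fin n)) (X : Fin n → E) : ‖mix R X‖ ≤ ‖X‖ := by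
  have := norm_mix_le (A := R) zero_le_one (fun i => ?_) X
  · simpa using this
  · rw [← Matrix.sum_row_of_mem_rowStochastic hR i]
    exact (Finset.sum_congr rfl fun j _ =>
      abs_of_nonneg (Matrix.nonneg_of_mem_rowStochastic hR)).le

end Averages

/-! ### Elementary inequalities -/

lemma add_sq_le_two (a b : ℝ) : (a + b) ^ 2 ≤ 2 * (a ^ 2 + b ^ 2) := by
  nlinarith [sq_nonneg (a - b)]

lemma add_sq_le_three (a b c : ℝ) : (a + b + c) ^ 2 ≤ 3 * (a ^ 2 + b ^ 2 + c ^ 2) := by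
  nlinarith [sq_nonneg (a - b), sq_nonneg (a - c), sq_nonneg (b - c)]

/-- Closing the loop between the consensus, tracking and momentum errors and the gradients. -/
lemma gradient_sum_le_of_coupled_errors {c l Q X Δ V M B G H N D P : ℝ} (hc : 1 ≤ c)
    (hl : 0 < l) (hl1 : l ≤ 1) (hs : 44 * c ^ 4 * l ^ 2 ≤ 1)
    (hQ : 0 ≤ Q) (hG : 0 ≤ G) (hN : 0 ≤ N) (hD : 0 ≤ D)
    (h1 : Q ≤ c * (V + B)) (h2 : X ≤ c * l ^ 4 * Q) (h3 : Δ ≤ c * l ^ 4 * Q)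
    (h4 : V ≤ c * l ^ 2 * (N + M + Δ)) (h5 : M ≤ c * (D / l + N + Δ / l ^ 2))
    (h6 : B ≤ c * (M + X + G)) (h7 : G ≤ 2 * H + c * l ^ 2 * B)
    (h8 : H ≤ P + c * (X + l ^ 2 * B + V) + c * l ^ 2 * (N + D)) :
    G ≤ 4 * P + 48 * c ^ 4 * (D + l ^ 2 * N) := by
  have hl2 : 0 < l ^ 2 := by positivity
  have hl21 : l ^ 2 ≤ 1 := pow_le_one₀ hl.le hl1
  have c1 : c ≤ c ^ 2 := by nlinarith
  have c2 : 1 ≤ c ^ 2 := by nlinarith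
  have c3 : c ^ 2 ≤ c ^ 4 := by nlinarith
  -- `A` collects the inputs of the loop and `q = l ^ 2 * Q` the feedback. Each error is first
  -- bounded by `A + q`; the smallness of `l` then gives `q ≤ (A + q) / 11`, so the feedback can be
  -- dropped.
  set A : ℝ := D / l + N + G with hA
  have hDl : 0 ≤ D / l := by positivity
  have hA0 : 0 ≤ A := by positivity
  set q : ℝ := l ^ 2 * Q with hq
  have hq0 : 0 ≤ q := by positivity
  have e4 : c * l ^ 4 * Q = c * l ^ 2 * q := by rw [hq]; ring
  rw [e4] at h2 h3
  have hcq : c * l ^ 2 * q ≤ c * q := by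
    have : c * q * l ^ 2 ≤ c * q * 1 := by gcongr
    linarith
  have hΔ2 : Δ / l ^ 2 ≤ c * q := by
    rw [div_le_iff₀ hl2]; linarith
  have hM : M ≤ c ^ 2 * (A + q) := by
    calc M ≤ c * (D / l + N + Δ / l ^ 2) := h5
      _ ≤ c * (A + c * q) := by gcongr; linarith
      _ = c * A + c ^ 2 * q := by ring
      _ ≤ c ^ 2 * A + c ^ 2 * q := by gcongr
      _ = _ := by ring
  have hcq2 : c * q ≤ c ^ 2 * q := by gcongr
  have hA2 : A ≤ c ^ 2 * A := by nlinarith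
  have hB : B ≤ 2 * c ^ 3 * (A + q) := by
    calc B ≤ c * (M + X + G) := h6
      _ ≤ c * (c ^ 2 * (A + q) + c ^ 2 * q + c ^ 2 * A) := by gcongr <;> linarith
      _ = _ := by ring
  have hV : V ≤ 2 * c ^ 3 * (A + q) * l ^ 2 := by
    calc V ≤ c * l ^ 2 * (N + M + Δ) := h4
      _ ≤ c * l ^ 2 * (c ^ 2 * A + c ^ 2 * (A + q) + c ^ 2 * q) := by gcongr <;> linarith
      _ = _ := by ring
  have hQ2 : Q ≤ 4 * c ^ 4 * (A + q) := by
    have hA3 : 0 ≤ 2 * c ^ 3 * (A + q) := by positivity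
    calc Q ≤ c * (V + B) := h1
      _ ≤ c * (2 * c ^ 3 * (A + q) + 2 * c ^ 3 * (A + q)) := by
          gcongr
          exact hV.trans (mul_le_of_le_one_right hA3 hl21)
      _ = _ := by ring
  have hqA : q ≤ A := by
    have h := mul_le_mul_of_nonneg_left hQ2 hl2.le
    have h' : 44 * c ^ 4 * l ^ 2 * (A + q) ≤ 1 * (A + q) := by gcongr
    have : q ≤ (A + q) / 11 := by
      calc q ≤ l ^ 2 * (4 * c ^ 4 * (A + q)) := h
        _ = (44 * c ^ 4 * l ^ 2 * (A + q)) / 11 := by ring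
        _ ≤ _ := by linarith
    linarith
  have hB' : B ≤ 4 * c ^ 3 * A := by
    calc B ≤ 2 * c ^ 3 * (A + q) := hB
      _ ≤ 2 * c ^ 3 * (A + A) := by gcongr
      _ = _ := by ring
  have hV' : V ≤ 4 * c ^ 3 * A * l ^ 2 := by
    calc V ≤ 2 * c ^ 3 * (A + q) * l ^ 2 := hV
      _ ≤ 2 * c ^ 3 * (A + A) * l ^ 2 := by gcongr
      _ = _ := by ring
  have hX' : X ≤ c * l ^ 2 * A := h2.trans (by gcongr)
  have hAl : l ^ 2 * A ≤ D + l ^ 2 * N + l ^ 2 * G := by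
    have : l ^ 2 * A = l * D + l ^ 2 * N + l ^ 2 * G := by rw [hA]; field_simp
    rw [this]
    have : l * D ≤ 1 * D := by gcongr
    linarith
  have hAl0 : 0 ≤ l ^ 2 * A := by positivity
  have hH : H ≤ P + 9 * c ^ 4 * (l ^ 2 * A) + c ^ 4 * (l ^ 2 * N + D) := by
    have t1 : c * (X + l ^ 2 * B + V) ≤ 9 * c ^ 4 * (l ^ 2 * A) := by
      calc c * (X + l ^ 2 * B + V)
          ≤ c * (c * l ^ 2 * A + l ^ 2 * (4 * c ^ 3 * A) + 4 * c ^ 3 * A * l ^ 2) := by gcongr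
        _ = c ^ 2 * (l ^ 2 * A) + 8 * c ^ 4 * (l ^ 2 * A) := by ring
        _ ≤ c ^ 4 * (l ^ 2 * A) + 8 * c ^ 4 * (l ^ 2 * A) := by gcongr
        _ = _ := by ring
    have t2 : c * l ^ 2 * (N + D) ≤ c ^ 4 * (l ^ 2 * N + D) := by
      calc c * l ^ 2 * (N + D) = c * (l ^ 2 * N + l ^ 2 * D) := by ring
        _ ≤ c ^ 4 * (l ^ 2 * N + 1 * D) := by gcongr; linarith
        _ = _ := by ring
    linarith
  have hG1 : G ≤ 2 * P + 22 * c ^ 4 * (l ^ 2 * A) + 2 * c ^ 4 * (l ^ 2 * N + D) := by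
    have t1 : c * l ^ 2 * B ≤ 4 * c ^ 4 * (l ^ 2 * A) := by
      calc c * l ^ 2 * B ≤ c * l ^ 2 * (4 * c ^ 3 * A) := by gcongr
        _ = _ := by ring
    linarith
  -- The gradients inside `A` come back with weight `22 * c ^ 4 * l ^ 2 ≤ 1 / 2` and are absorbed on
  -- the left, which doubles the other constants.
  have hG2 : 22 * c ^ 4 * (l ^ 2 * A) ≤ 22 * c ^ 4 * (D + l ^ 2 * N) + G / 2 := by
    have t1 : 22 * c ^ 4 * (l ^ 2 * A) ≤ 22 * c ^ 4 * (D + l ^ 2 * N + l ^ 2 * G) := by gcongr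
    have t2 : 44 * c ^ 4 * l ^ 2 * G ≤ 1 * G := by gcongr
    linarith
  linarith

/-! ### Pathwise analysis -/

/-- A trajectory of the algorithm driven by the fields `h i` with additive noise `e`. The value
`e 0` is chosen such that the noisy field vanishes at the start. -/
structure IsTrajectory {n d : ℕ} (R C : Matrix (Fin n) (Fin n) ℝ) (η lam : ℝ)
    (h : Fin n → Vec d → Vec d) (x₀ : Vec d) (x m v e : ℕ → Fin n → Vec d) : Prop where
  x_zero : x 0 = fun _ => x₀
  m_zero : m 0 = 0
  v_zero : v 0 = 0
  e_zero : e 0 = -fun i => h i x₀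
  x_succ : ∀ k, x (k + 1) = mix R (x k - η • v k)
  m_succ : ∀ k, m (k + 1) =
    (1 - lam) • m k + lam • ((fun i => h i (x (k + 1) i)) + e (k + 1))
  v_succ : ∀ k, v (k + 1) = mix C (v k) + (m (k + 1) - m k)

/-- The average of the previous momentum. -/
def prevAvg {n d : ℕ} (m : ℕ → Fin n → Vec d) : ℕ → Vec d
  | 0 => 0
  | k + 1 => avg (m k)

/-- The virtual sequence of a trajectory. -/
def virtualSeq {n d : ℕ} (πR πC : Fin n → ℝ) (η lam : ℝ) (x m : ℕ → Fin n → Vec d) (k : ℕ) :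
    Vec d :=
  ∑ i, πR i • x k i - (η * cPi πR πC * (1 - lam) / lam) • prevAvg m k

/-- The deviation from the weighted average. -/
def consensusDev {n d : ℕ} (πR : Fin n → ℝ) (X : Fin n → Vec d) : Fin n → Vec d :=
  X - fun _ => ∑ j, πR j • X j

/-- The deviation from the stationary profile. -/
def trackingDev {n d : ℕ} (πC : Fin n → ℝ) (V : Fin n → Vec d) : Fin n → Vec d :=
  V - fun i => πC i • ∑ j, V j

/-! ### Consensus and tracking deviations under mixing -/

section Deviations

variable {n d : ℕ} {R C : Matrix (Fin n) (Fin n) ℝ} {πR πC : Fin n → ℝ}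

lemma mix_const (hR : R ∈ Matrix.rowStochastic ℝ (Fin n)) (z : Vec d) :
    mix R (fun _ => z) = fun _ => z := by
  ext1 i
  simp only [mix]
  rw [← Finset.sum_smul, Matrix.sum_row_of_mem_rowStochastic hR, one_smul]

lemma sum_smul_mix (hπ : IsLeftStationary R πR) (X : Fin n → Vec d) :
    ∑ i, πR i • mix R X i = ∑ i, πR i • X i := by
  simp only [mix, Finset.smul_sum, smul_smul]
  rw [Finset.sum_comm]
  refine Finset.sum_congr rfl fun j _ => ?_
  rw [← Finset.sum_smul]
  congr 1
  exact congrFun hπ.2 j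

lemma sum_mix_colStochastic (hC : C ∈ Matrix.colStochastic ℝ (Fin n)) (X : Fin n → Vec d) :
    ∑ i, mix C X i = ∑ i, X i := by
  simp only [mix]
  rw [Finset.sum_comm]
  refine Finset.sum_congr rfl fun j _ => ?_
  rw [← Finset.sum_smul, Matrix.sum_col_of_mem_colStochastic hC, one_smul]

lemma mix_vecMulVec_one_left (π : Fin n → ℝ) (X : Fin n → Vec d) :
    mix (Matrix.vecMulVec (1 : Fin n → ℝ) π) X = fun _ => ∑ j, π j • X j := by
  ext1 i; simp [mix, Matrix.vecMulVec_apply]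

lemma mix_vecMulVec_one_right (π : Fin n → ℝ) (X : Fin n → Vec d) :
    mix (Matrix.vecMulVec π (1 : Fin n → ℝ)) X = fun i => π i • ∑ j, X j := by
  ext1 i; simp [mix, Matrix.vecMulVec_apply, Finset.smul_sum]

/-- `R` commutes with the projection `1 πᵀ`, and that projection annihilates deviations. Subtracting
it is therefore free, and it removes the eigenvalue one. -/
lemma consensusDev_mix (hR : R ∈ Matrix.rowStochastic ℝ (Fin n)) (hπ : IsLeftStationary R πR)
    (X : Fin n → Vec d) :
    consensusDev πR (mix R X) =
      mix (R - Matrix.vecMulVec (1 : Fin n → ℝ) πR) (consensusDev πR X) := by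
  rw [sub_mix, mix_vecMulVec_one_left, consensusDev, consensusDev, mix_sub, mix_const hR]
  simp only [sum_smul_mix hπ, Pi.sub_apply, smul_sub, Finset.sum_sub_distrib]
  rw [← Finset.sum_smul, hπ.1.2]
  ext1 i
  simp

lemma consensusDev_sub (X Y : Fin n → Vec d) :
    consensusDev πR (X - Y) = consensusDev πR X - consensusDev πR Y := by
  ext1 i; simp [consensusDev, smul_sub, Finset.sum_sub_distrib]; abel

lemma norm_consensusDev_le (hπ : πR ∈ stdSimplex ℝ (Fin n)) (X : Fin n → Vec d) :
    ‖consensusDev πR X‖ ≤ 2 * ‖X‖ := by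
  refine (pi_norm_le_iff_of_nonneg (by positivity)).2 fun i => ?_
  calc ‖X i - ∑ j, πR j • X j‖ ≤ ‖X i‖ + ‖∑ j, πR j • X j‖ := norm_sub_le _ _
    _ ≤ ‖X‖ + ‖X‖ := add_le_add (norm_le_pi_norm X i) (norm_weighted_sum_le hπ X)
    _ = _ := by ring

lemma trackingDev_mix (hC : C ∈ Matrix.colStochastic ℝ (Fin n)) (hπ : IsRightStationary C πC)
    (V : Fin n → Vec d) :
    trackingDev πC (mix C V) =
      mix (C - Matrix.vecMulVec πC (1 : Fin n → ℝ)) (trackingDev πC V) := by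
  have h1 : mix C (fun i => πC i • ∑ j, V j) = fun i => πC i • ∑ j, V j := by
    ext1 i
    simp only [mix, smul_smul]
    rw [← Finset.sum_smul]
    congr 1
    exact congrFun hπ.2 i
  rw [sub_mix, mix_vecMulVec_one_right, trackingDev, trackingDev, mix_sub, h1]
  simp only [sum_mix_colStochastic hC, Pi.sub_apply, Finset.sum_sub_distrib]
  rw [← Finset.sum_smul, hπ.1.2, one_smul, sub_self]
  ext1 i
  simp

lemma trackingDev_add (X Y : Fin n → Vec d) :
    trackingDev πC (X + Y) = trackingDev πC X + trackingDev πC Y := by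
  ext1 i; simp [trackingDev, smul_add, Finset.sum_add_distrib]; abel

lemma norm_sum_le_card_mul (X : Fin n → Vec d) : ‖∑ j, X j‖ ≤ n * ‖X‖ := by
  calc ‖∑ j, X j‖ ≤ ∑ _j : Fin n, ‖X‖ := norm_sum_le_of_le _ fun j _ => norm_le_pi_norm X j
    _ = n * ‖X‖ := by simp

lemma norm_trackingDev_le (hπ : πC ∈ stdSimplex ℝ (Fin n)) (X : Fin n → Vec d) :
    ‖trackingDev πC X‖ ≤ (1 + n) * ‖X‖ := by
  refine (pi_norm_le_iff_of_nonneg (by positivity)).2 fun i => ?_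
  have h1 : ‖πC i • ∑ j, X j‖ ≤ n * ‖X‖ := by
    rw [norm_smul, Real.norm_eq_abs, abs_of_nonneg (hπ.1 i)]
    exact (mul_le_of_le_one_left (norm_nonneg _) ((mem_Icc_of_mem_stdSimplex hπ i).2)).trans
      (norm_sum_le_card_mul X)
  calc ‖X i - πC i • ∑ j, X j‖ ≤ ‖X i‖ + ‖πC i • ∑ j, X j‖ := norm_sub_le _ _
    _ ≤ ‖X‖ + n * ‖X‖ := add_le_add (norm_le_pi_norm X i) h1
    _ = _ := by ring

end Deviations

/-! ### Consensus, tracking and momentum errors along a trajectory -/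

namespace IsTrajectory

variable {n d : ℕ} {R C : Matrix (Fin n) (Fin n) ℝ} {πR πC : Fin n → ℝ} {η lam L : ℝ}
  {h : Fin n → Vec d → Vec d} {x₀ : Vec d} {x m v e : ℕ → Fin n → Vec d}

/-- The tracking invariant: mixing by `C` conserves the total, and the increments of the momenta
telescope from a zero start. -/
lemma sum_v (H : IsTrajectory R C η lam h x₀ x m v e)
    (hC : C ∈ Matrix.colStochastic ℝ (Fin n)) (k : ℕ) : ∑ i, v k i = ∑ i, m k i := by
  induction k with
  | zero => simp [H.v_zero, H.m_zero]
  | succ k ih =>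
    rw [H.v_succ]
    simp only [Pi.add_apply, Pi.sub_apply, Finset.sum_add_distrib, Finset.sum_sub_distrib]
    rw [sum_mix_colStochastic hC, ih]
    abel

lemma sum_v_eq (H : IsTrajectory R C η lam h x₀ x m v e)
    (hC : C ∈ Matrix.colStochastic ℝ (Fin n)) (hn : 0 < n) (k : ℕ) :
    ∑ i, v k i = (n : ℝ) • avg (m k) := by
  have : (n : ℝ) ≠ 0 := by positivity
  rw [H.sum_v hC, avg, smul_smul, mul_one_div_cancel this, one_smul]

/-- All agents start at the same point, so the deviation solves the stable recursion from zero,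
driven by `η • v k` alone. -/
lemma sum_sq_consensus_le (H : IsTrajectory R C η lam h x₀ x m v e)
    (hR : R ∈ Matrix.rowStochastic ℝ (Fin n)) (hπ : IsLeftStationary R πR) {c : ℝ} (hc : 0 ≤ c)
    (hst : IsStableWith (R - Matrix.vecMulVec (1 : Fin n → ℝ) πR) c) (T : ℕ) :
    ∑ k ∈ Finset.range T, ‖consensusDev πR (x k)‖ ^ 2
      ≤ 4 * c * η ^ 2 * ∑ k ∈ Finset.range T, ‖v k‖ ^ 2 := by
  refine (hst d (fun k => consensusDev πR (x k))
    (fun k => -consensusDev πR (mix R (η • v k))) ?_ (fun k => ?_) T).trans ?_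
  · rw [H.x_zero]
    ext1 i
    simp [consensusDev, ← Finset.sum_smul, hπ.1.2]
  · rw [H.x_succ, mix_sub, consensusDev_sub, consensusDev_mix hR hπ, sub_eq_add_neg]
  · have : ∀ k, ‖-consensusDev πR (mix R (η • v k))‖ ^ 2 ≤ 4 * η ^ 2 * ‖v k‖ ^ 2 := fun k => by
      have h1 : ‖consensusDev πR (mix R (η • v k))‖ ≤ 2 * (|η| * ‖v k‖) := by
        rw [← Real.norm_eq_abs, ← norm_smul]
        exact (norm_consensusDev_le hπ.1 _).trans (by
          gcongr; exact norm_mix_rowStochastic_le hR _)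
      rw [norm_neg]
      calc _ ≤ (2 * (|η| * ‖v k‖)) ^ 2 := by gcongr
        _ = _ := by rw [mul_pow, mul_pow, sq_abs]; ring
    calc _ ≤ c * ∑ k ∈ Finset.range T, 4 * η ^ 2 * ‖v k‖ ^ 2 := by
          gcongr with k _; exact this k
      _ = _ := by rw [← Finset.mul_sum]; ring

lemma sum_sq_tracking_le (H : IsTrajectory R C η lam h x₀ x m v e)
    (hC : C ∈ Matrix.colStochastic ℝ (Fin n)) (hπ : IsRightStationary C πC) {c : ℝ} (hc : 0 ≤ c)
    (hst : IsStableWith (C - Matrix.vecMulVec πC (1 : Fin n → ℝ)) c) (T : ℕ) :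
    ∑ k ∈ Finset.range T, ‖trackingDev πC (v k)‖ ^ 2
      ≤ c * (1 + n) ^ 2 * ∑ k ∈ Finset.range T, ‖m (k + 1) - m k‖ ^ 2 := by
  refine (hst d (fun k => trackingDev πC (v k))
    (fun k => trackingDev πC (m (k + 1) - m k)) ?_ (fun k => ?_) T).trans ?_
  · rw [H.v_zero]
    ext1 i
    simp [trackingDev]
  · rw [H.v_succ, trackingDev_add, trackingDev_mix hC hπ]
  · calc _ ≤ c * ∑ k ∈ Finset.range T, ((1 + n) * ‖m (k + 1) - m k‖) ^ 2 := by
          gcongr with k _; exact norm_trackingDev_le hπ.1 _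
      _ = _ := by simp_rw [mul_pow]; rw [← Finset.mul_sum]; ring

/-- `R` fixes the consensus part of `x k`, so an iterate moves only through its deviation and the
step. -/
lemma norm_x_succ_sub_le (H : IsTrajectory R C η lam h x₀ x m v e)
    (hR : R ∈ Matrix.rowStochastic ℝ (Fin n)) (k : ℕ) :
    ‖x (k + 1) - x k‖ ≤ 2 * ‖consensusDev πR (x k)‖ + |η| * ‖v k‖ := by
  have e1 : x (k + 1) - x k =
      mix R (consensusDev πR (x k)) - consensusDev πR (x k) - mix R (η • v k) := by
    rw [H.x_succ, mix_sub, consensusDev, mix_sub, mix_const hR]; abel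
  rw [e1, ← Real.norm_eq_abs, ← norm_smul]
  calc _ ≤ ‖mix R (consensusDev πR (x k))‖ + ‖consensusDev πR (x k)‖ + ‖mix R (η • v k)‖ :=
        (norm_sub_le _ _).trans (by gcongr; exact norm_sub_le _ _)
    _ ≤ ‖consensusDev πR (x k)‖ + ‖consensusDev πR (x k)‖ + ‖η • v k‖ := by
        gcongr <;> exact norm_mix_rowStochastic_le hR _
    _ = _ := by ring

lemma norm_v_le (H : IsTrajectory R C η lam h x₀ x m v e)
    (hC : C ∈ Matrix.colStochastic ℝ (Fin n)) (hn : 0 < n) (hπ : πC ∈ stdSimplex ℝ (Fin n))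
    (k : ℕ) : ‖v k‖ ≤ ‖trackingDev πC (v k)‖ + n * ‖avg (m k)‖ := by
  have e1 : v k = trackingDev πC (v k) + fun i => πC i • ∑ j, v k j := by
    rw [trackingDev, sub_add_cancel]
  have h1 : ‖fun i => πC i • ∑ j, v k j‖ ≤ n * ‖avg (m k)‖ := by
    refine (pi_norm_le_iff_of_nonneg (by positivity)).2 fun i => ?_
    rw [norm_smul, Real.norm_eq_abs, abs_of_nonneg (hπ.1 i), H.sum_v_eq hC hn, norm_smul,
      Real.norm_natCast]
    exact mul_le_of_le_one_left (by positivity) ((mem_Icc_of_mem_stdSimplex hπ i).2)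
  calc ‖v k‖ = ‖trackingDev πC (v k) + fun i => πC i • ∑ j, v k j‖ := by rw [← e1]
    _ ≤ _ := (norm_add_le _ _).trans (by gcongr)

lemma norm_field_sub_le (hL : 0 ≤ L) (hh : ∀ i y z, ‖h i y - h i z‖ ≤ L * ‖y - z‖)
    (X Y : Fin n → Vec d) :
    ‖(fun i => h i (X i)) - fun i => h i (Y i)‖ ≤ L * ‖X - Y‖ :=
  (pi_norm_le_iff_of_nonneg (by positivity)).2 fun i => (hh i _ _).trans (by
    gcongr; exact norm_le_pi_norm (X - Y) i)

lemma norm_stale_momentum_le (hL : 0 ≤ L) (hh : ∀ i y z, ‖h i y - h i z‖ ≤ L * ‖y - z‖) (k : ℕ) :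
    ‖m k - fun i => h i (x (k + 1) i)‖ ≤
      ‖m k - fun i => h i (x k i)‖ + L * ‖x (k + 1) - x k‖ := by
  have e1 : (m k - fun i => h i (x (k + 1) i)) = (m k - fun i => h i (x k i))
      - ((fun i => h i (x (k + 1) i)) - fun i => h i (x k i)) := by abel
  rw [e1]
  exact (norm_sub_le _ _).trans (by gcongr; exact norm_field_sub_le hL hh _ _)

lemma norm_m_succ_sub_le (H : IsTrajectory R C η lam h x₀ x m v e) (hl : 0 ≤ lam)
    (hL : 0 ≤ L) (hh : ∀ i y z, ‖h i y - h i z‖ ≤ L * ‖y - z‖) (k : ℕ) :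
    ‖m (k + 1) - m k‖ ≤ lam *
      (‖e (k + 1)‖ + ‖m k - fun i => h i (x k i)‖ + L * ‖x (k + 1) - x k‖) := by
  have e1 : m (k + 1) - m k = lam • (e (k + 1) - (m k - fun i => h i (x (k + 1) i))) := by
    rw [H.m_succ]; module
  rw [e1, norm_smul, Real.norm_eq_abs, abs_of_nonneg hl, add_assoc]
  gcongr
  exact (norm_sub_le _ _).trans (by gcongr; exact norm_stale_momentum_le hL hh k)

/-- Averaging with weight `lam` contracts the old error, while the drift of the iterates costs `1 /
lam`. Convexity of the square replaces any orthogonality of the noise, so the estimate holds on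
every path, with noise weight `lam` and not `lam ^ 2`. -/
lemma momentum_error_step (H : IsTrajectory R C η lam h x₀ x m v e) (hl : 0 < lam) (hl1 : lam ≤ 1)
    (hL : 0 ≤ L) (hh : ∀ i y z, ‖h i y - h i z‖ ≤ L * ‖y - z‖) (k : ℕ) :
    ‖m (k + 1) - fun i => h i (x (k + 1) i)‖ ^ 2 ≤
      (1 - lam / 2) * ‖m k - fun i => h i (x k i)‖ ^ 2
        + 2 / lam * (L ^ 2 * ‖x (k + 1) - x k‖ ^ 2) + lam * ‖e (k + 1)‖ ^ 2 := by
  set U := m k - fun i => h i (x (k + 1) i) with hU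
  set a := ‖m k - fun i => h i (x k i)‖
  set b := L * ‖x (k + 1) - x k‖ with hb
  have e1 : (m (k + 1) - fun i => h i (x (k + 1) i)) = (1 - lam) • U + lam • e (k + 1) := by
    rw [H.m_succ, hU]; module
  have hUle : ‖U‖ ≤ a + b := norm_stale_momentum_le hL hh k
  have h1 : ‖m (k + 1) - fun i => h i (x (k + 1) i)‖ ≤ (1 - lam) * (a + b) + lam * ‖e (k + 1)‖ := by
    rw [e1]
    refine (norm_add_le _ _).trans ?_
    rw [norm_smul, norm_smul, Real.norm_eq_abs, Real.norm_eq_abs, abs_of_pos hl,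
      abs_of_nonneg (by linarith)]
    have : 0 ≤ 1 - lam := by linarith
    gcongr
  have h2 : ((1 - lam) * (a + b) + lam * ‖e (k + 1)‖) ^ 2 ≤
      (1 - lam) * (a + b) ^ 2 + lam * ‖e (k + 1)‖ ^ 2 := by
    have : 0 ≤ lam * (1 - lam) := mul_nonneg hl.le (by linarith)
    nlinarith [mul_nonneg this (sq_nonneg (a + b - ‖e (k + 1)‖))]
  -- Young's inequality with weight `lam / 2` spends half of the contraction `1 - lam` on the drift.
  have h3 : (a + b) ^ 2 ≤ (1 + lam / 2) * a ^ 2 + (1 + 2 / lam) * b ^ 2 := by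
    have : (1 + lam / 2) * a ^ 2 + (1 + 2 / lam) * b ^ 2 - (a + b) ^ 2
        = (lam * a - 2 * b) ^ 2 / (2 * lam) := by field_simp; ring
    have : 0 ≤ (lam * a - 2 * b) ^ 2 / (2 * lam) := by positivity
    linarith
  have h4 : (1 - lam) * (a + b) ^ 2 ≤ (1 - lam / 2) * a ^ 2 + 2 / lam * b ^ 2 := by
    have t1 : (1 - lam) * (a + b) ^ 2 ≤
        (1 - lam) * ((1 + lam / 2) * a ^ 2 + (1 + 2 / lam) * b ^ 2) :=
      mul_le_mul_of_nonneg_left h3 (by linarith)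
    have t2 : (1 - lam) * ((1 + lam / 2) * a ^ 2 + (1 + 2 / lam) * b ^ 2)
        = (1 - lam / 2) * a ^ 2 + 2 / lam * b ^ 2
          - (lam ^ 2 / 2 * a ^ 2 + (1 + lam) * b ^ 2) := by field_simp; ring
    have t3 : 0 ≤ lam ^ 2 / 2 * a ^ 2 + (1 + lam) * b ^ 2 := by positivity
    linarith
  calc _ ≤ ((1 - lam) * (a + b) + lam * ‖e (k + 1)‖) ^ 2 := by gcongr
    _ ≤ _ := h2
    _ ≤ _ := by rw [← mul_pow, ← hb]; linarith

lemma sum_sq_momentum_error_le (H : IsTrajectory R C η lam h x₀ x m v e) (hl : 0 < lam)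
    (hl1 : lam ≤ 1) (hL : 0 ≤ L) (hh : ∀ i y z, ‖h i y - h i z‖ ≤ L * ‖y - z‖) (T : ℕ) :
    ∑ k ∈ Finset.range T, ‖m k - fun i => h i (x k i)‖ ^ 2 ≤
      2 * (‖fun i => h i x₀‖ ^ 2 / lam) + 2 * ∑ k ∈ Finset.range T, ‖e (k + 1)‖ ^ 2
        + 4 * L ^ 2 * ((∑ k ∈ Finset.range T, ‖x (k + 1) - x k‖ ^ 2) / lam ^ 2) := by
  have hsum : ‖m T - fun i => h i (x T i)‖ ^ 2
      + lam / 2 * ∑ k ∈ Finset.range T, ‖m k - fun i => h i (x k i)‖ ^ 2 ≤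
      ‖fun i => h i x₀‖ ^ 2 + 2 / lam * L ^ 2 * ∑ k ∈ Finset.range T, ‖x (k + 1) - x k‖ ^ 2
        + lam * ∑ k ∈ Finset.range T, ‖e (k + 1)‖ ^ 2 := by
    induction T with
    | zero => simp [H.m_zero, H.x_zero]
    | succ T ih =>
      rw [Finset.sum_range_succ, Finset.sum_range_succ, Finset.sum_range_succ]
      linarith [H.momentum_error_step hl hl1 hL hh T]
  have h1 : lam / 2 * ∑ k ∈ Finset.range T, ‖m k - fun i => h i (x k i)‖ ^ 2 ≤
      ‖fun i => h i x₀‖ ^ 2 + 2 / lam * L ^ 2 * ∑ k ∈ Finset.range T, ‖x (k + 1) - x k‖ ^ 2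
        + lam * ∑ k ∈ Finset.range T, ‖e (k + 1)‖ ^ 2 := by
    linarith [sq_nonneg ‖m T - fun i => h i (x T i)‖]
  rw [mul_comm, ← le_div_iff₀ (by positivity)] at h1
  refine h1.trans_eq ?_
  field_simp
  ring

lemma norm_avg_field_sub_le (hL : 0 ≤ L) (hh : ∀ i y z, ‖h i y - h i z‖ ≤ L * ‖y - z‖)
    (X : Fin n → Vec d) (z : Vec d) :
    ‖avg (fun i => h i (X i)) - avg (fun i => h i z)‖ ≤ L * ‖X - fun _ => z‖ := by
  rw [← avg_sub]
  exact (norm_avg_le _).trans (norm_field_sub_le hL hh X fun _ => z)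

lemma norm_avg_m_le (hL : 0 ≤ L) (hh : ∀ i y z, ‖h i y - h i z‖ ≤ L * ‖y - z‖) (k : ℕ) :
    ‖avg (m k)‖ ≤ ‖m k - fun i => h i (x k i)‖ + L * ‖consensusDev πR (x k)‖
      + ‖avg fun i => h i (∑ j, πR j • x k j)‖ := by
  have e1 : avg (m k) = avg (m k - fun i => h i (x k i))
      + (avg (fun i => h i (x k i)) - avg (fun i => h i (∑ j, πR j • x k j)))
      + avg (fun i => h i (∑ j, πR j • x k j)) := by
    rw [avg_sub]; abel
  conv_lhs => rw [e1]
  refine (norm_add_le _ _).trans (by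
    gcongr
    refine (norm_add_le _ _).trans (add_le_add (norm_avg_le _) ?_)
    exact norm_avg_field_sub_le hL hh _ _)

/-- The conventions `prevAvg m 0 = 0` and `e 0 = -h(x₀)` make the averaged recursion hold at `k = 0`
as well, so the virtual sequence needs no special first step. -/
lemma avg_m_eq (H : IsTrajectory R C η lam h x₀ x m v e) (k : ℕ) :
    avg (m k) = (1 - lam) • prevAvg m k + lam • avg ((fun i => h i (x k i)) + e k) := by
  cases k with
  | zero => simp [H.m_zero, H.e_zero, H.x_zero, prevAvg, avg_zero]
  | succ k => rw [H.m_succ, avg_add, avg_smul, avg_smul, prevAvg]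

/-- Adding the correction `η c (1 - lam) / lam` to the step weight `η c` gives `η c / lam`. Then
`avg (m k) / lam` splits into the previous correction and the current noisy gradient, so the
momentum cancels. -/
lemma virtualSeq_succ (H : IsTrajectory R C η lam h x₀ x m v e)
    (hπ : IsLeftStationary R πR) (hC : C ∈ Matrix.colStochastic ℝ (Fin n))
    (hn : 0 < n) (hl : lam ≠ 0) (k : ℕ) :
    virtualSeq πR πC η lam x m (k + 1) = virtualSeq πR πC η lam x m k
      - η • (cPi πR πC • avg ((fun i => h i (x k i)) + e k)
        + ∑ i, πR i • trackingDev πC (v k) i) := by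
  have e1 : ∑ i, πR i • x (k + 1) i = ∑ i, πR i • x k i - η • ∑ i, πR i • v k i := by
    rw [H.x_succ, sum_smul_mix hπ]
    simp only [Pi.sub_apply, Pi.smul_apply, smul_sub, Finset.sum_sub_distrib, Finset.smul_sum]
    congr 1
    exact Finset.sum_congr rfl fun i _ => smul_comm _ _ _
  have e2 : ∑ i, πR i • v k i = cPi πR πC • avg (m k) + ∑ i, πR i • trackingDev πC (v k) i := by
    simp only [trackingDev, Pi.sub_apply, smul_sub, Finset.sum_sub_distrib, smul_smul]
    rw [← Finset.sum_smul, H.sum_v_eq hC hn, smul_smul, cPi, mul_comm (n : ℝ)]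
    simp [dotProduct]
  have e3 := H.avg_m_eq k
  rw [virtualSeq, virtualSeq, e1, e2, prevAvg]
  set w := ∑ i, πR i • trackingDev πC (v k) i
  set gb := avg ((fun i => h i (x k i)) + e k)
  set c := cPi πR πC
  have e4 : η • c • avg (m k) + (η * c * (1 - lam) / lam) • avg (m k)
      = (η * c * (1 - lam) / lam) • prevAvg m k + (η * c) • gb := by
    rw [smul_smul, ← add_smul]
    have : η * c + η * c * (1 - lam) / lam = η * c / lam := by field_simp; ring
    rw [this, e3, smul_add, smul_smul, smul_smul]
    congr 2 <;> field_simp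
  have e5 : η • (c • avg (m k) + w) = η • c • avg (m k) + η • w := smul_add _ _ _
  have e6 : η • (c • gb + w) = (η * c) • gb + η • w := by rw [smul_add, smul_smul]
  rw [e5, e6]
  calc _ = ∑ i, πR i • x k i - (η • c • avg (m k) + (η * c * (1 - lam) / lam) • avg (m k)) - η • w := by
        abel
    _ = _ := by rw [e4]; abel

end IsTrajectory

/-! ### Descent along the virtual sequence -/

namespace IsTrajectory

variable {n d : ℕ} {R C : Matrix (Fin n) (Fin n) ℝ} {πR πC : Fin n → ℝ} {η lam L : ℝ}
  {h : Fin n → Vec d → Vec d} {x₀ : Vec d} {x m v e : ℕ → Fin n → Vec d}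

lemma virtualSeq_zero (H : IsTrajectory R C η lam h x₀ x m v e)
    (hπ : πR ∈ stdSimplex ℝ (Fin n)) : virtualSeq πR πC η lam x m 0 = x₀ := by
  simp [virtualSeq, prevAvg, H.x_zero, ← Finset.sum_smul, hπ.2]

lemma norm_xbar_sub_virtualSeq_le (hη : 0 ≤ η) (hl : 0 < lam) (hl1 : lam ≤ 1)
    (hc : 0 ≤ cPi πR πC) (k : ℕ) :
    ‖∑ i, πR i • x k i - virtualSeq πR πC η lam x m k‖
      ≤ η * cPi πR πC / lam * ‖prevAvg m k‖ := by
  rw [virtualSeq, sub_sub_cancel, norm_smul, Real.norm_eq_abs, abs_of_nonneg]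
  · refine mul_le_mul_of_nonneg_right (div_le_div_of_nonneg_right ?_ hl.le) (norm_nonneg _)
    exact mul_le_of_le_one_right (by positivity) (by linarith)
  · have : 0 ≤ 1 - lam := by linarith
    positivity

/-- The part of the update direction of the virtual sequence that is neither the gradient nor
noise. -/
def residual (πR πC : Fin n → ℝ) (η lam : ℝ) (h : Fin n → Vec d → Vec d)
    (x m v : ℕ → Fin n → Vec d) (k : ℕ) : Vec d :=
  cPi πR πC • (avg (fun i => h i (x k i)) - avg fun i => h i (virtualSeq πR πC η lam x m k))
    + ∑ i, πR i • trackingDev πC (v k) i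

lemma norm_residual_le (hπ : πR ∈ stdSimplex ℝ (Fin n)) (hη : 0 ≤ η) (hl : 0 < lam)
    (hl1 : lam ≤ 1) (hc : 0 ≤ cPi πR πC) (hL : 0 ≤ L)
    (hh : ∀ i y z, ‖h i y - h i z‖ ≤ L * ‖y - z‖) (k : ℕ) :
    ‖residual πR πC η lam h x m v k‖ ≤ cPi πR πC * L * ‖consensusDev πR (x k)‖
      + cPi πR πC * L * (η * cPi πR πC / lam * ‖prevAvg m k‖) + ‖trackingDev πC (v k)‖ := by
  set z := virtualSeq πR πC η lam x m k with hz
  have h1 : ‖x k - fun _ => z‖ ≤ ‖consensusDev πR (x k)‖ + η * cPi πR πC / lam * ‖prevAvg m k‖ := by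
    have e1 : (x k - fun _ => z) =
        consensusDev πR (x k) + fun _ => (∑ i, πR i • x k i - z) := by
      ext1 i; simp [consensusDev]
    rw [e1]
    refine (norm_add_le _ _).trans (add_le_add le_rfl ?_)
    exact (pi_norm_le_iff_of_nonneg (by positivity)).2 fun _ =>
      norm_xbar_sub_virtualSeq_le hη hl hl1 hc k
  have h2 := norm_avg_field_sub_le hL hh (x k) z
  calc _ ≤ ‖cPi πR πC • (avg (fun i => h i (x k i)) - avg fun i => h i z)‖
        + ‖∑ i, πR i • trackingDev πC (v k) i‖ := norm_add_le _ _
    _ ≤ cPi πR πC * (L * (‖consensusDev πR (x k)‖ + η * cPi πR πC / lam * ‖prevAvg m k‖))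
        + ‖trackingDev πC (v k)‖ := by
        rw [norm_smul, Real.norm_eq_abs, abs_of_nonneg hc]
        gcongr
        · exact h2.trans (by gcongr)
        · exact norm_weighted_sum_le hπ _
    _ = _ := by ring

/-- Of the decrease `η c ‖G‖²`, one half pays for the residual by Young's inequality and one quarter
for the second-order term, using `12 L η c ≤ 1`. The cross term with the noise is kept exactly,
because only its expectation vanishes. -/
lemma descent_step (H : IsTrajectory R C η lam h x₀ x m v e)
    (hπ : IsLeftStationary R πR) (hC : C ∈ Matrix.colStochastic ℝ (Fin n))
    (hn : 0 < n) (hη : 0 ≤ η) (hl : lam ≠ 0) (hc : 0 < cPi πR πC) (hL : 0 ≤ L)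
    (hLη : 12 * L * η * cPi πR πC ≤ 1) {F : Vec d → ℝ}
    (hF : ∀ y z, F z ≤ F y + inner ℝ (avg fun i => h i y) (z - y) + L * ‖z - y‖ ^ 2) (k : ℕ) :
    F (virtualSeq πR πC η lam x m (k + 1)) ≤ F (virtualSeq πR πC η lam x m k)
      - η * cPi πR πC / 4 * ‖avg fun i => h i (virtualSeq πR πC η lam x m k)‖ ^ 2
      - η * cPi πR πC *
          inner ℝ (avg fun i => h i (virtualSeq πR πC η lam x m k)) (avg (e k))
      + η / cPi πR πC * ‖residual πR πC η lam h x m v k‖ ^ 2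
      + 3 * L * cPi πR πC ^ 2 * η ^ 2 * ‖e k‖ ^ 2 := by
  set z := virtualSeq πR πC η lam x m k with hz
  set G := avg fun i => h i z with hG
  set r := residual πR πC η lam h x m v k with hr
  set c := cPi πR πC with hcdef
  have e1 : virtualSeq πR πC η lam x m (k + 1) = z - η • (c • G + c • avg (e k) + r) := by
    rw [H.virtualSeq_succ hπ hC hn hl k, avg_add, hr, residual, ← hz, ← hG]
    module
  have h1 := hF z (virtualSeq πR πC η lam x m (k + 1))
  rw [e1, sub_sub_cancel_left, inner_neg_right, norm_neg, inner_smul_right, inner_add_right,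
    inner_add_right, inner_smul_right, inner_smul_right, real_inner_self_eq_norm_sq, norm_smul,
    Real.norm_eq_abs, abs_of_nonneg hη, ← e1] at h1
  have h2 : ‖c • G + c • avg (e k) + r‖ ^ 2 ≤
      3 * (c ^ 2 * ‖G‖ ^ 2 + c ^ 2 * ‖e k‖ ^ 2 + ‖r‖ ^ 2) := by
    have t : ‖c • G + c • avg (e k) + r‖ ≤ c * ‖G‖ + c * ‖e k‖ + ‖r‖ := by
      refine (norm_add_le _ _).trans (add_le_add ((norm_add_le _ _).trans ?_) le_rfl)
      rw [norm_smul, norm_smul, Real.norm_eq_abs, abs_of_pos hc]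
      gcongr
      exact norm_avg_le _
    calc _ ≤ (c * ‖G‖ + c * ‖e k‖ + ‖r‖) ^ 2 := by gcongr
      _ ≤ _ := add_sq_le_three _ _ _
      _ = _ := by ring
  have h3 : -(c / 2 * ‖G‖ ^ 2 + ‖r‖ ^ 2 / (2 * c)) ≤ inner ℝ G r := by
    have t1 : -(‖G‖ * ‖r‖) ≤ inner ℝ G r := neg_le_of_abs_le (abs_real_inner_le_norm G r)
    have t2 : c / 2 * ‖G‖ ^ 2 + ‖r‖ ^ 2 / (2 * c) - ‖G‖ * ‖r‖ = (c * ‖G‖ - ‖r‖) ^ 2 / (2 * c) := by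
      field_simp; ring
    have t3 : 0 ≤ (c * ‖G‖ - ‖r‖) ^ 2 / (2 * c) := by positivity
    linarith
  have h4 : L * (η * ‖c • G + c • avg (e k) + r‖) ^ 2 ≤
      L * η ^ 2 * (3 * (c ^ 2 * ‖G‖ ^ 2 + c ^ 2 * ‖e k‖ ^ 2 + ‖r‖ ^ 2)) := by
    rw [mul_pow, ← mul_assoc]; gcongr
  have h5 : 3 * L * η ^ 2 * c ^ 2 * ‖G‖ ^ 2 ≤ η * c / 4 * ‖G‖ ^ 2 := by
    calc _ = (12 * L * η * c) * (η * c / 4 * ‖G‖ ^ 2) := by ring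
      _ ≤ 1 * (η * c / 4 * ‖G‖ ^ 2) := by gcongr
      _ = _ := by ring
  have h6 : 3 * L * η ^ 2 * ‖r‖ ^ 2 ≤ η * (‖r‖ ^ 2 / (2 * c)) := by
    calc _ = (12 * L * η * c) * (η * (‖r‖ ^ 2 / (4 * c))) := by field_simp; ring
      _ ≤ 1 * (η * (‖r‖ ^ 2 / (4 * c))) := by gcongr
      _ ≤ η * (‖r‖ ^ 2 / (2 * c)) := by rw [one_mul]; gcongr; norm_num
  have h7 : η / c * ‖r‖ ^ 2 = η * (‖r‖ ^ 2 / (2 * c)) + η * (‖r‖ ^ 2 / (2 * c)) := by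
    field_simp; ring
  have h8 := mul_le_mul_of_nonneg_left h3 hη
  rw [h7]
  linarith

lemma sum_descent (H : IsTrajectory R C η lam h x₀ x m v e)
    (hπ : IsLeftStationary R πR) (hC : C ∈ Matrix.colStochastic ℝ (Fin n))
    (hn : 0 < n) (hη : 0 < η) (hl : lam ≠ 0) (hc : 0 < cPi πR πC) (hL : 0 ≤ L)
    (hLη : 12 * L * η * cPi πR πC ≤ 1) {F : Vec d → ℝ}
    (hF : ∀ y z, F z ≤ F y + inner ℝ (avg fun i => h i y) (z - y) + L * ‖z - y‖ ^ 2)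
    {Fs : ℝ} (hFs : ∀ y, Fs ≤ F y) (T : ℕ) :
    ∑ k ∈ Finset.range T, ‖avg fun i => h i (virtualSeq πR πC η lam x m k)‖ ^ 2 ≤
      (4 / (cPi πR πC * η) * (F x₀ - Fs)
      - 4 * ∑ k ∈ Finset.range T,
          inner ℝ (avg fun i => h i (virtualSeq πR πC η lam x m k)) (avg (e k)))
      + 4 / cPi πR πC ^ 2 * ∑ k ∈ Finset.range T, ‖residual πR πC η lam h x m v k‖ ^ 2
      + 12 * L * cPi πR πC * η * ∑ k ∈ Finset.range T, ‖e k‖ ^ 2 := by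
  set c := cPi πR πC with hcdef
  have hsum : η * c / 4 *
        ∑ k ∈ Finset.range T, ‖avg fun i => h i (virtualSeq πR πC η lam x m k)‖ ^ 2 ≤
      F x₀ - F (virtualSeq πR πC η lam x m T)
      - η * c * ∑ k ∈ Finset.range T,
          inner ℝ (avg fun i => h i (virtualSeq πR πC η lam x m k)) (avg (e k))
      + η / c * ∑ k ∈ Finset.range T, ‖residual πR πC η lam h x m v k‖ ^ 2
      + 3 * L * c ^ 2 * η ^ 2 * ∑ k ∈ Finset.range T, ‖e k‖ ^ 2 := by
    induction T with
    | zero => simp [H.virtualSeq_zero hπ.1]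
    | succ T ih =>
      simp only [Finset.sum_range_succ, mul_add]
      linarith [H.descent_step hπ hC hn hη.le hl hc hL hLη hF T]
  have h1 := hFs (virtualSeq πR πC η lam x m T)
  set S := ∑ k ∈ Finset.range T, ‖avg fun i => h i (virtualSeq πR πC η lam x m k)‖ ^ 2
  set I := ∑ k ∈ Finset.range T,
          inner ℝ (avg fun i => h i (virtualSeq πR πC η lam x m k)) (avg (e k))
  set A := ∑ k ∈ Finset.range T, ‖residual πR πC η lam h x m v k‖ ^ 2
  set B := ∑ k ∈ Finset.range T, ‖e k‖ ^ 2
  have h2 : η * c / 4 * S ≤ F x₀ - Fs - η * c * I + η / c * A + 3 * L * c ^ 2 * η ^ 2 * B := by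
    linarith
  rw [mul_comm, ← le_div_iff₀ (by positivity)] at h2
  refine h2.trans_eq ?_
  field_simp
  ring

lemma sum_sq_prevAvg_le (m : ℕ → Fin n → Vec d) (T : ℕ) :
    ∑ k ∈ Finset.range T, ‖prevAvg m k‖ ^ 2 ≤ ∑ k ∈ Finset.range T, ‖avg (m k)‖ ^ 2 := by
  cases T with
  | zero => simp
  | succ T =>
    rw [Finset.sum_range_succ', Finset.sum_range_succ]
    simp only [prevAvg, norm_zero]
    nlinarith [sq_nonneg ‖avg (m T)‖]

lemma sum_sq_noise_le (H : IsTrajectory R C η lam h x₀ x m v e) (T : ℕ) :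
    ∑ k ∈ Finset.range T, ‖e k‖ ^ 2 ≤
      ∑ k ∈ Finset.range T, ‖e (k + 1)‖ ^ 2 + ‖fun i => h i x₀‖ ^ 2 := by
  have h0 : ‖e 0‖ = ‖fun i => h i x₀‖ := by rw [H.e_zero, norm_neg]
  rw [← h0, ← Finset.sum_range_succ' (fun k => ‖e k‖ ^ 2), Finset.sum_range_succ]
  nlinarith [sq_nonneg ‖e T‖]

end IsTrajectory

/-! ### The coupled system of square sums -/

lemma sum_sq_le_two {ι : Type*} (s : Finset ι) {a b c : ι → ℝ} (ha : ∀ k, 0 ≤ a k)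
    (h : ∀ k, a k ≤ b k + c k) :
    ∑ k ∈ s, a k ^ 2 ≤ 2 * (∑ k ∈ s, b k ^ 2 + ∑ k ∈ s, c k ^ 2) := by
  rw [← Finset.sum_add_distrib, Finset.mul_sum]
  exact Finset.sum_le_sum fun k _ => (pow_le_pow_left₀ (ha k) (h k) 2).trans (add_sq_le_two _ _)

lemma sum_sq_le_three {ι : Type*} (s : Finset ι) {a b c e : ι → ℝ} (ha : ∀ k, 0 ≤ a k)
    (h : ∀ k, a k ≤ b k + c k + e k) :
    ∑ k ∈ s, a k ^ 2 ≤ 3 * (∑ k ∈ s, b k ^ 2 + ∑ k ∈ s, c k ^ 2 + ∑ k ∈ s, e k ^ 2) := by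
  rw [← Finset.sum_add_distrib, ← Finset.sum_add_distrib, Finset.mul_sum]
  exact Finset.sum_le_sum fun k _ => (pow_le_pow_left₀ (ha k) (h k) 2).trans
    (add_sq_le_three _ _ _)

set_option maxHeartbeats 800000 in
open IsTrajectory in
/-- The pathwise bound on the gradients along the consensus average. -/
theorem exists_pathwise_gradient_bound {n : ℕ} {GR GC : Digraph (Fin n)}
    {R C : Matrix (Fin n) (Fin n) ℝ} (hnet : NetworkAssumption GR GC R C)
    {πR πC : Fin n → ℝ} (hπR : IsLeftStationary R πR) (hπC : IsRightStationary C πC)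
    {L b : ℝ} (hL : 0 ≤ L) (hb : 0 ≤ b) :
    ∃ c : ℝ, 1 ≤ c ∧ ∀ lam η : ℝ, 0 < lam → lam ≤ 1 → 44 * c ^ 4 * lam ^ 2 ≤ 1 → 0 < η →
      η ≤ b * lam ^ 2 → ∀ (d : ℕ) (h : Fin n → Vec d → Vec d) (x₀ : Vec d)
      (x m v e : ℕ → Fin n → Vec d) (F : Vec d → ℝ) (Fs : ℝ),
      IsTrajectory R C η lam h x₀ x m v e →
      (∀ i y z, ‖h i y - h i z‖ ≤ L * ‖y - z‖) →
      (∀ y z, F z ≤ F y + inner ℝ (avg fun i => h i y) (z - y) + L * ‖z - y‖ ^ 2) →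
      (∀ y, Fs ≤ F y) → ∀ T : ℕ,
      ∑ k ∈ Finset.range T, ‖avg fun i => h i (∑ j, πR j • x k j)‖ ^ 2 ≤
        4 * (4 / (cPi πR πC * η) * (F x₀ - Fs) - 4 * ∑ k ∈ Finset.range T,
          inner ℝ (avg fun i => h i (virtualSeq πR πC η lam x m k)) (avg (e k)))
        + 48 * c ^ 4 * (‖fun i => h i x₀‖ ^ 2
          + lam ^ 2 * ∑ k ∈ Finset.range T, ‖e (k + 1)‖ ^ 2) := by
  obtain ⟨c₁, hc₁, hst₁⟩ := exists_isStableWith_row hnet hπR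
  obtain ⟨c₂, hc₂, hst₂⟩ := exists_isStableWith_col hnet hπC
  have hn : 0 < n := by
    obtain ⟨r, -⟩ := hnet.exists_root
    exact Fin.pos r
  have hcp := cPi_pos hnet hπR hπC
  set p := cPi πR πC with hp
  -- One constant for each coupled estimate: `κ₁` to `κ₇` for `v`, consensus, increments, tracking,
  -- momentum error, mean momentum and the passage from `x̄` to the virtual sequence; `κ₈` for the
  -- residual, `κ₉` for the second-order noise. Their sum plus one dominates all of them, and
  -- through `κ₉` the smallness of `lam` also yields the step-size condition of the descent.
  set κ₁ : ℝ := 2 * n ^ 2 + 2 with hκ₁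
  set κ₂ : ℝ := 4 * c₁ * b ^ 2 with hκ₂
  set κ₃ : ℝ := 2 * (4 * κ₂ + b ^ 2) with hκ₃
  set κ₄ : ℝ := c₂ * (1 + n) ^ 2 * 3 * (1 + L ^ 2) with hκ₄
  set κ₅ : ℝ := 2 + 4 * L ^ 2 with hκ₅
  set κ₆ : ℝ := 3 * (1 + L ^ 2) with hκ₆
  set κ₇ : ℝ := 2 * (L * p * b) ^ 2 with hκ₇
  set κ₈ : ℝ := 12 / p ^ 2 * ((p * L) ^ 2 + (p * L * (p * b)) ^ 2 + 1) with hκ₈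
  set κ₉ : ℝ := 12 * L * p * b with hκ₉
  have k₁ : 0 ≤ κ₁ := by positivity
  have k₂ : 0 ≤ κ₂ := by positivity
  have k₃ : 0 ≤ κ₃ := by positivity
  have k₄ : 0 ≤ κ₄ := by positivity
  have k₅ : 0 ≤ κ₅ := by positivity
  have k₆ : 0 ≤ κ₆ := by positivity
  have k₇ : 0 ≤ κ₇ := by positivity
  have k₈ : 0 ≤ κ₈ := by positivity
  have k₉ : 0 ≤ κ₉ := by positivity
  obtain ⟨c, hc⟩ : ∃ c, c = 1 + κ₁ + κ₂ + κ₃ + κ₄ + κ₅ + κ₆ + κ₇ + κ₈ + κ₉ := ⟨_, rfl⟩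
  have hc1 : 1 ≤ c := by linarith
  refine ⟨c, hc1, fun lam η hl hl1 hs hη hηb d h x₀ x m v e F Fs H hh hF hFs T => ?_⟩
  have hηsq : η ^ 2 ≤ b ^ 2 * lam ^ 4 := by
    calc η ^ 2 ≤ (b * lam ^ 2) ^ 2 := by gcongr
      _ = _ := by ring
  have hηl : η / lam ≤ b * lam := by rw [div_le_iff₀ hl]; linarith
  have hLη : 12 * L * η * p ≤ 1 := by
    have hc4 : c ≤ c ^ 4 := le_self_pow₀ hc1 (by norm_num)
    calc 12 * L * η * p ≤ 12 * L * (b * lam ^ 2) * p := by gcongr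
      _ = κ₉ * lam ^ 2 := by rw [hκ₉]; ring
      _ ≤ 44 * c ^ 4 * lam ^ 2 := by gcongr; linarith
      _ ≤ 1 := hs
  have hN : ∃ N, N = ∑ k ∈ Finset.range T, ‖e (k + 1)‖ ^ 2 := ⟨_, rfl⟩
  have hQ : ∃ Q, Q = ∑ k ∈ Finset.range T, ‖v k‖ ^ 2 := ⟨_, rfl⟩
  have hX : ∃ X, X = ∑ k ∈ Finset.range T, ‖consensusDev πR (x k)‖ ^ 2 := ⟨_, rfl⟩
  have hΔ : ∃ Δ, Δ = ∑ k ∈ Finset.range T, ‖x (k + 1) - x k‖ ^ 2 := ⟨_, rfl⟩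
  have hV : ∃ V, V = ∑ k ∈ Finset.range T, ‖trackingDev πC (v k)‖ ^ 2 := ⟨_, rfl⟩
  have hM : ∃ M, M = ∑ k ∈ Finset.range T, ‖m k - fun i => h i (x k i)‖ ^ 2 := ⟨_, rfl⟩
  have hB : ∃ B, B = ∑ k ∈ Finset.range T, ‖avg (m k)‖ ^ 2 := ⟨_, rfl⟩
  have hG : ∃ G, G = ∑ k ∈ Finset.range T, ‖avg fun i => h i (∑ j, πR j • x k j)‖ ^ 2 := ⟨_, rfl⟩
  have hS : ∃ S, S = ∑ k ∈ Finset.range T,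
      ‖avg fun i => h i (virtualSeq πR πC η lam x m k)‖ ^ 2 := ⟨_, rfl⟩
  have hW : ∃ W, W = ∑ k ∈ Finset.range T, ‖residual πR πC η lam h x m v k‖ ^ 2 := ⟨_, rfl⟩
  have hA : ∃ A, A = ∑ k ∈ Finset.range T, ‖m (k + 1) - m k‖ ^ 2 := ⟨_, rfl⟩
  have hD : ∃ D, D = ‖fun i => h i x₀‖ ^ 2 := ⟨_, rfl⟩
  obtain ⟨N, hN⟩ := hN
  obtain ⟨Q, hQ⟩ := hQ
  obtain ⟨X, hX⟩ := hX
  obtain ⟨Δ, hΔ⟩ := hΔ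
  obtain ⟨V, hV⟩ := hV
  obtain ⟨M, hM⟩ := hM
  obtain ⟨B, hB⟩ := hB
  obtain ⟨G, hG⟩ := hG
  obtain ⟨S, hS⟩ := hS
  obtain ⟨W, hW⟩ := hW
  obtain ⟨A, hA⟩ := hA
  obtain ⟨D, hD⟩ := hD
  have nN : 0 ≤ N := hN ▸ Finset.sum_nonneg fun _ _ => sq_nonneg _
  have nD : 0 ≤ D := hD ▸ sq_nonneg _
  have nQ : 0 ≤ Q := hQ ▸ Finset.sum_nonneg fun _ _ => sq_nonneg _
  have nX : 0 ≤ X := hX ▸ Finset.sum_nonneg fun _ _ => sq_nonneg _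
  have nΔ : 0 ≤ Δ := hΔ ▸ Finset.sum_nonneg fun _ _ => sq_nonneg _
  have nV : 0 ≤ V := hV ▸ Finset.sum_nonneg fun _ _ => sq_nonneg _
  have nM : 0 ≤ M := hM ▸ Finset.sum_nonneg fun _ _ => sq_nonneg _
  have nB : 0 ≤ B := hB ▸ Finset.sum_nonneg fun _ _ => sq_nonneg _
  have nG : 0 ≤ G := hG ▸ Finset.sum_nonneg fun _ _ => sq_nonneg _
  have tQ : Q ≤ 2 * (V + n ^ 2 * B) := by
    have t := sum_sq_le_two (Finset.range T) (fun k => norm_nonneg (v k))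
      (fun k => H.norm_v_le hnet.col_stochastic hn hπC.1 k)
    simp only [mul_pow, ← Finset.mul_sum] at t
    rwa [← hQ, ← hV, ← hB] at t
  have tX : X ≤ 4 * c₁ * η ^ 2 * Q := by
    have t := H.sum_sq_consensus_le hnet.row_stochastic hπR hc₁.le hst₁ T
    rwa [← hX, ← hQ] at t
  have tΔ : Δ ≤ 2 * (2 ^ 2 * X + η ^ 2 * Q) := by
    have t := sum_sq_le_two (Finset.range T) (fun k => norm_nonneg (x (k + 1) - x k))
      (fun k => H.norm_x_succ_sub_le (πR := πR) hnet.row_stochastic k)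
    simp only [mul_pow, sq_abs, ← Finset.mul_sum] at t
    rwa [← hΔ, ← hX, ← hQ] at t
  have tA : A ≤ 3 * (lam ^ 2 * N + lam ^ 2 * M + lam ^ 2 * (L ^ 2 * Δ)) := by
    have t := sum_sq_le_three (Finset.range T) (fun k => norm_nonneg (m (k + 1) - m k))
      (fun k => (H.norm_m_succ_sub_le hl.le hL hh k).trans_eq (by rw [mul_add, mul_add]))
    simp only [mul_pow, ← Finset.mul_sum] at t
    rwa [← hA, ← hN, ← hM, ← hΔ] at t
  have tV : V ≤ c₂ * (1 + n) ^ 2 * A := by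
    have t := H.sum_sq_tracking_le hnet.col_stochastic hπC hc₂.le hst₂ T
    rwa [← hV, ← hA] at t
  have tM : M ≤ 2 * (D / lam) + 2 * N + 4 * L ^ 2 * (Δ / lam ^ 2) := by
    have t := H.sum_sq_momentum_error_le hl hl1 hL hh T
    rwa [← hM, ← hD, ← hN, ← hΔ] at t
  have tB : B ≤ 3 * (M + L ^ 2 * X + G) := by
    have t := sum_sq_le_three (Finset.range T) (fun k => norm_nonneg (avg (m k)))
      (fun k => norm_avg_m_le (m := m) (x := x) (πR := πR) hL hh k)
    simp only [mul_pow, ← Finset.mul_sum] at t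
    rwa [← hB, ← hM, ← hX, ← hG] at t
  have hprev : ∑ k ∈ Finset.range T, ‖prevAvg m k‖ ^ 2 ≤ B := hB ▸ sum_sq_prevAvg_le m T
  have hηp : (η * p / lam) ^ 2 ≤ (p * b) ^ 2 * lam ^ 2 := by
    calc (η * p / lam) ^ 2 = (p * (η / lam)) ^ 2 := by ring
      _ ≤ (p * (b * lam)) ^ 2 := by gcongr
      _ = _ := by ring
  have tG : G ≤ 2 * (S + L ^ 2 * ((p * b) ^ 2 * lam ^ 2 * B)) := by
    have t := sum_sq_le_two (Finset.range T)
      (fun k => norm_nonneg (avg fun i => h i (∑ j, πR j • x k j)))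
      (b := fun k => ‖avg fun i => h i (virtualSeq πR πC η lam x m k)‖)
      (c := fun k => L * (η * p / lam * ‖prevAvg m k‖)) (fun k => by
        have t1 := norm_avg_field_sub_le hL hh (fun _ => ∑ j, πR j • x k j)
          (virtualSeq πR πC η lam x m k)
        have t2 : ‖(fun _ : Fin n => ∑ j, πR j • x k j) -
            fun _ => virtualSeq πR πC η lam x m k‖ ≤ η * p / lam * ‖prevAvg m k‖ :=
          (pi_norm_le_iff_of_nonneg (by positivity)).2 fun _ =>
            norm_xbar_sub_virtualSeq_le hη.le hl hl1 hcp.le k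
        have t3 := mul_le_mul_of_nonneg_left t2 hL
        have t4 := norm_sub_norm_le (avg fun i => h i (∑ j, πR j • x k j))
          (avg fun i => h i (virtualSeq πR πC η lam x m k))
        linarith)
    simp only [mul_pow L, mul_pow (η * p / lam), ← Finset.mul_sum] at t
    rw [← hG, ← hS] at t
    refine t.trans ?_
    gcongr
  have tW : W ≤ 3 * ((p * L) ^ 2 * X + (p * L) ^ 2 * ((p * b) ^ 2 * lam ^ 2 * B) + V) := by
    have t := sum_sq_le_three (Finset.range T)
      (fun k => norm_nonneg (residual πR πC η lam h x m v k))
      (fun k => norm_residual_le (x := x) (m := m) (v := v) hπR.1 hη.le hl hl1 hcp.le hL hh k)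
    simp only [← hp, mul_pow (p * L), mul_pow (η * p / lam), ← Finset.mul_sum] at t
    rw [← hW, ← hX, ← hV] at t
    refine t.trans ?_
    gcongr
  have tS := H.sum_descent hπR hnet.col_stochastic hn hη hl.ne' hcp hL hLη hF hFs T
  have tN := H.sum_sq_noise_le T
  rw [← hN, ← hD] at tN
  rw [← hS, ← hW, ← hp] at tS
  rw [← hG, ← hN, ← hD]
  clear hG hN hD hS hW hQ hX hΔ hV hM hB hA
  clear_value p κ₁ κ₂ κ₃ κ₄ κ₅ κ₆ κ₇ κ₈ κ₉
  have h1 : Q ≤ c * (V + B) := by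
    calc Q ≤ 2 * (V + n ^ 2 * B) := tQ
      _ ≤ κ₁ * (V + B) := by
        rw [hκ₁]
        have : 0 ≤ 2 * (n : ℝ) ^ 2 * V := by positivity
        linarith
      _ ≤ c * (V + B) := by gcongr; linarith
  have h2' : X ≤ κ₂ * lam ^ 4 * Q := by
    calc X ≤ 4 * c₁ * η ^ 2 * Q := tX
      _ ≤ 4 * c₁ * (b ^ 2 * lam ^ 4) * Q := by gcongr
      _ = _ := by rw [hκ₂]; ring
  have h2 : X ≤ c * lam ^ 4 * Q := h2'.trans (by gcongr; linarith)
  have h3 : Δ ≤ c * lam ^ 4 * Q := by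
    calc Δ ≤ 2 * (2 ^ 2 * X + η ^ 2 * Q) := tΔ
      _ ≤ 2 * (2 ^ 2 * (κ₂ * lam ^ 4 * Q) + b ^ 2 * lam ^ 4 * Q) := by gcongr
      _ = κ₃ * lam ^ 4 * Q := by rw [hκ₃]; ring
      _ ≤ _ := by gcongr; linarith
  have h4 : V ≤ c * lam ^ 2 * (N + M + Δ) := by
    calc V ≤ c₂ * (1 + n) ^ 2 * A := tV
      _ ≤ c₂ * (1 + n) ^ 2 *
          (3 * (lam ^ 2 * N + lam ^ 2 * M + lam ^ 2 * (L ^ 2 * Δ))) := by gcongr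
      _ = c₂ * (1 + n) ^ 2 * 3 * lam ^ 2 * (N + M + L ^ 2 * Δ) := by ring
      _ ≤ c₂ * (1 + n) ^ 2 * 3 * lam ^ 2 * ((1 + L ^ 2) * (N + M + Δ)) := by
          gcongr
          have : 0 ≤ L ^ 2 * (N + M) := by positivity
          linarith
      _ = κ₄ * lam ^ 2 * (N + M + Δ) := by rw [hκ₄]; ring
      _ ≤ _ := by gcongr; linarith
  have h5 : M ≤ c * (D / lam + N + Δ / lam ^ 2) := by
    have n1 : 0 ≤ D / lam := by positivity
    have n2 : 0 ≤ Δ / lam ^ 2 := by positivity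
    calc M ≤ 2 * (D / lam) + 2 * N + 4 * L ^ 2 * (Δ / lam ^ 2) := tM
      _ ≤ κ₅ * (D / lam + N + Δ / lam ^ 2) := by
          rw [hκ₅]
          have : 0 ≤ 4 * L ^ 2 * (D / lam + N) := by positivity
          linarith
      _ ≤ _ := by gcongr; linarith
  have h6 : B ≤ c * (M + X + G) := by
    calc B ≤ 3 * (M + L ^ 2 * X + G) := tB
      _ ≤ κ₆ * (M + X + G) := by
          rw [hκ₆]
          have : 0 ≤ L ^ 2 * (M + G) := by positivity
          linarith
      _ ≤ _ := by gcongr; linarith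
  have h7 : G ≤ 2 * S + c * lam ^ 2 * B := by
    calc G ≤ 2 * (S + L ^ 2 * ((p * b) ^ 2 * lam ^ 2 * B)) := tG
      _ = 2 * S + κ₇ * lam ^ 2 * B := by rw [hκ₇]; ring
      _ ≤ _ := by gcongr; linarith
  refine gradient_sum_le_of_coupled_errors hc1 hl hl1 hs nQ nG nN nD h1 h2 h3 h4 h5 h6 h7 ?_
  have tr : 4 / p ^ 2 * W ≤ c * (X + lam ^ 2 * B + V) := by
    calc _ ≤ 4 / p ^ 2 * (3 * ((p * L) ^ 2 * X +
          (p * L) ^ 2 * ((p * b) ^ 2 * lam ^ 2 * B) + V)) := by gcongr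
      _ = 12 / p ^ 2 * ((p * L) ^ 2 * X + (p * L * (p * b)) ^ 2 * (lam ^ 2 * B) + 1 * V) := by
          ring
      _ ≤ 12 / p ^ 2 * (((p * L) ^ 2 + (p * L * (p * b)) ^ 2 + 1) * X +
          ((p * L) ^ 2 + (p * L * (p * b)) ^ 2 + 1) * (lam ^ 2 * B) +
          ((p * L) ^ 2 + (p * L * (p * b)) ^ 2 + 1) * V) := by
          have n1 : 0 ≤ (p * L) ^ 2 := by positivity
          have n2 : 0 ≤ (p * L * (p * b)) ^ 2 := by positivity
          gcongr <;> linarith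
      _ = κ₈ * (X + lam ^ 2 * B + V) := by rw [hκ₈]; ring
      _ ≤ _ := by gcongr; linarith
  have tn : 12 * L * p * η * ∑ k ∈ Finset.range T, ‖e k‖ ^ 2 ≤ c * lam ^ 2 * (N + D) := by
    calc _ ≤ 12 * L * p * (b * lam ^ 2) * (N + D) := by gcongr
      _ = κ₉ * lam ^ 2 * (N + D) := by rw [hκ₉]; ring
      _ ≤ _ := by gcongr; linarith
  linarith

/-! ### The objective -/

section Objective

variable {n d : ℕ} {f : Fin n → Vec d → ℝ} {L : ℝ}

/-- Serves to replace `L` by `|L|`, as no sign of `L` is assumed. -/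
lemma ObjectiveAssumption.mono {L' : ℝ} (h : ObjectiveAssumption f L) (hL : L ≤ L') :
    ObjectiveAssumption f L' :=
  ⟨h.differentiable, h.bddBelow, fun i x y => (h.lipschitz i x y).trans (by gcongr)⟩

lemma ObjectiveAssumption.hasGradientAt (h : ObjectiveAssumption f L) (x : Vec d) :
    HasGradientAt (objective f) (avg fun i => gradient (f i) x) x := by
  have h1 : HasFDerivAt (fun x => ∑ i, f i x) (∑ i, fderiv ℝ (f i) x) x :=
    HasFDerivAt.fun_sum fun i _ => (h.differentiable i x).hasFDerivAt
  have h2 := h1.const_mul (1 / (n : ℝ))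
  rw [hasGradientAt_iff_hasFDerivAt, avg, map_smul, map_sum]
  simp only [toDual_gradient]
  exact h2

lemma ObjectiveAssumption.gradient_eq (h : ObjectiveAssumption f L) (x : Vec d) :
    gradient (objective f) x = avg fun i => gradient (f i) x :=
  (h.hasGradientAt x).gradient

/-- The mean value theorem at a single point of the segment suffices; it gives `L` instead of the
sharp `L / 2`. -/
lemma ObjectiveAssumption.descent (h : ObjectiveAssumption f L) (hL : 0 ≤ L) (y z : Vec d) :
    objective f z ≤ objective f y + inner ℝ (avg fun i => gradient (f i) y) (z - y)
      + L * ‖z - y‖ ^ 2 := by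
  obtain ⟨w, hw, e⟩ := domain_mvt (s := Set.univ) (x := y) (y := z)
    (fun x _ => (h.hasGradientAt x).hasFDerivAt.hasFDerivWithinAt) convex_univ
    (Set.mem_univ _) (Set.mem_univ _)
  rw [InnerProductSpace.toDual_apply_apply] at e
  have h1 : ‖(avg fun i => gradient (f i) w) - avg fun i => gradient (f i) y‖ ≤ L * ‖z - y‖ := by
    refine (IsTrajectory.norm_avg_field_sub_le (h := fun i => gradient (f i)) hL h.lipschitz
      (fun _ => w) y).trans ?_
    gcongr
    refine (pi_norm_le_iff_of_nonneg (norm_nonneg _)).2 fun _ => ?_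
    obtain ⟨t, ht, rfl⟩ := (segment_eq_image' ℝ y z ▸ hw : w ∈ _)
    simp only [Pi.sub_apply, add_sub_cancel_left, norm_smul, Real.norm_eq_abs, abs_of_nonneg ht.1]
    exact mul_le_of_le_one_left (norm_nonneg _) ht.2
  have h2 := real_inner_le_norm ((avg fun i => gradient (f i) w) - avg fun i => gradient (f i) y)
    (z - y)
  rw [inner_sub_left] at h2
  have h3 : ‖(avg fun i => gradient (f i) w) - avg fun i => gradient (f i) y‖ * ‖z - y‖ ≤
      L * ‖z - y‖ * ‖z - y‖ := by gcongr
  nlinarith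

lemma ObjectiveAssumption.optValue_le (h : ObjectiveAssumption f L) (x : Vec d) :
    optValue f ≤ objective f x := by
  choose b hb using h.bddBelow
  refine ciInf_le ⟨(1 / (n : ℝ)) * ∑ i, b i, ?_⟩ x
  rintro _ ⟨y, rfl⟩
  exact mul_le_mul_of_nonneg_left (Finset.sum_le_sum fun i _ => hb i ⟨y, rfl⟩) (by positivity)

lemma ObjectiveAssumption.continuous_gradient (h : ObjectiveAssumption f L) (hL : 0 ≤ L)
    (i : Fin n) : Continuous (gradient (f i)) :=
  (LipschitzWith.of_dist_le_mul (K := L.toNNReal) fun x y => by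
    simpa [dist_eq_norm, hL] using h.lipschitz i x y).continuous

end Objective

/-! ### The stochastic oracle at an independent point -/

section Oracle

variable {Ω Ξ E : Type*} [MeasurableSpace Ω] [MeasurableSpace Ξ] {μ : Measure Ω}
  [IsProbabilityMeasure μ]

/-- A square-integrable map of bounded variance, uniformly in a parameter, stays so when the
parameter is random and independent of the sample. -/
lemma memLp_of_indepFun {α : Type*} [MeasurableSpace α] [NormedAddCommGroup E]
    [MeasurableSpace E] [BorelSpace E] [SecondCountableTopology E]
    {D : Measure Ξ} {φ : α → Ξ → E} (hφ : Measurable (Function.uncurry φ))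
    (hL2 : ∀ a, MemLp (φ a) 2 D) {σ : ℝ} (hσ : ∀ a, ∫ s, ‖φ a s‖ ^ 2 ∂D ≤ σ ^ 2)
    {Z : Ω → α} {W : Ω → Ξ} (hZ : Measurable Z) (hW : Measurable W) (hlaw : μ.map W = D)
    (hind : IndepFun Z W μ) :
    MemLp (fun ω => φ (Z ω) (W ω)) 2 μ ∧ ∫ ω, ‖φ (Z ω) (W ω)‖ ^ 2 ∂μ ≤ σ ^ 2 := by
  have hmeas : Measurable fun ω => φ (Z ω) (W ω) := hφ.comp (hZ.prodMk hW)
  have : IsProbabilityMeasure D := hlaw ▸ Measure.isProbabilityMeasure_map hW.aemeasurable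
  have : IsProbabilityMeasure (μ.map Z) := Measure.isProbabilityMeasure_map hZ.aemeasurable
  have hφ2 : Measurable fun p : α × Ξ => ENNReal.ofReal (‖φ p.1 p.2‖ ^ 2) :=
    (hφ.norm.pow_const 2).ennreal_ofReal
  -- By independence the joint law is a product. Working with the lower integral needs no prior
  -- integrability, so finiteness and the bound come out together.
  have hle : ∫⁻ ω, ENNReal.ofReal (‖φ (Z ω) (W ω)‖ ^ 2) ∂μ ≤ ENNReal.ofReal (σ ^ 2) := by
    calc ∫⁻ ω, ENNReal.ofReal (‖φ (Z ω) (W ω)‖ ^ 2) ∂μ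
        = ∫⁻ p, ENNReal.ofReal (‖φ p.1 p.2‖ ^ 2) ∂(μ.map fun ω => (Z ω, W ω)) :=
          (lintegral_map hφ2 (hZ.prodMk hW)).symm
      _ = ∫⁻ a, ∫⁻ s, ENNReal.ofReal (‖φ a s‖ ^ 2) ∂D ∂(μ.map Z) := by
          rw [hind.map_prod_eq_prod_map_map hZ.aemeasurable hW.aemeasurable, hlaw,
            lintegral_prod _ hφ2.aemeasurable]
      _ ≤ ∫⁻ _a, ENNReal.ofReal (σ ^ 2) ∂(μ.map Z) := by
          refine lintegral_mono fun a => ?_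
          have hi : Integrable (fun s => ‖φ a s‖ ^ 2) D :=
            (memLp_two_iff_integrable_sq_norm (hL2 a).1).1 (hL2 a)
          dsimp only
          rw [← ofReal_integral_eq_lintegral_ofReal hi (ae_of_all _ fun _ => sq_nonneg _)]
          exact ENNReal.ofReal_le_ofReal (hσ a)
      _ = ENNReal.ofReal (σ ^ 2) := by simp
  have hint : Integrable (fun ω => ‖φ (Z ω) (W ω)‖ ^ 2) μ :=
    ⟨(hmeas.norm.pow_const 2).aestronglyMeasurable,
      (hasFiniteIntegral_iff_ofReal (ae_of_all _ fun _ => sq_nonneg _)).2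
        (hle.trans_lt ENNReal.ofReal_lt_top)⟩
  refine ⟨(memLp_two_iff_integrable_sq_norm hmeas.aestronglyMeasurable).2 hint, ?_⟩
  rw [← ofReal_integral_eq_lintegral_ofReal hint (ae_of_all _ fun _ => sq_nonneg _)] at hle
  exact (ENNReal.ofReal_le_ofReal_iff (sq_nonneg σ)).1 hle

lemma integrable_inner_of_memLp {μ : Measure Ω} [NormedAddCommGroup E] [InnerProductSpace ℝ E] {u v : Ω → E}
    (hu : MemLp u 2 μ) (hv : MemLp v 2 μ) : Integrable (fun ω => inner ℝ (u ω) (v ω)) μ := by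
  refine Integrable.mono' (hu.norm.integrable_mul hv.norm) (hu.1.inner hv.1)
    (ae_of_all _ fun ω => ?_)
  exact norm_inner_le_norm _ _

/-- A centred sample is orthogonal to everything it is independent of. -/
lemma integral_inner_eq_zero_of_indepFun {α : Type*} [MeasurableSpace α] [NormedAddCommGroup E]
    [InnerProductSpace ℝ E] [CompleteSpace E]
    [MeasurableSpace E] [BorelSpace E] [SecondCountableTopology E]
    {D : Measure Ξ} {φ : α → Ξ → E} (hφ : Measurable (Function.uncurry φ))
    (hint : ∀ a, Integrable (φ a) D) (hzero : ∀ a, ∫ s, φ a s ∂D = 0)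
    {Z : Ω → α} {W : Ω → Ξ} (hZ : Measurable Z) (hW : Measurable W) (hlaw : μ.map W = D)
    (hind : IndepFun Z W μ) {u : α → E} (hu : Measurable u) (hu2 : MemLp (fun ω => u (Z ω)) 2 μ)
    (hφ2 : MemLp (fun ω => φ (Z ω) (W ω)) 2 μ) :
    ∫ ω, inner ℝ (u (Z ω)) (φ (Z ω) (W ω)) ∂μ = 0 := by
  have : IsProbabilityMeasure D := hlaw ▸ Measure.isProbabilityMeasure_map hW.aemeasurable
  have : IsProbabilityMeasure (μ.map Z) := Measure.isProbabilityMeasure_map hZ.aemeasurable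
  have hψ : Measurable fun p : α × Ξ => (inner ℝ (u p.1) (φ p.1 p.2) : ℝ) :=
    (hu.comp measurable_fst).inner hφ
  have hmap := hind.map_prod_eq_prod_map_map hZ.aemeasurable hW.aemeasurable
  rw [hlaw] at hmap
  have hpair : AEMeasurable (fun ω => (Z ω, W ω)) μ := (hZ.prodMk hW).aemeasurable
  have hi : Integrable (fun p : α × Ξ => (inner ℝ (u p.1) (φ p.1 p.2) : ℝ))
      ((μ.map Z).prod D) := by
    rw [← hmap, integrable_map_measure hψ.aestronglyMeasurable hpair]
    exact integrable_inner_of_memLp hu2 hφ2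
  calc ∫ ω, inner ℝ (u (Z ω)) (φ (Z ω) (W ω)) ∂μ
      = ∫ p, inner ℝ (u p.1) (φ p.1 p.2) ∂(μ.map fun ω => (Z ω, W ω)) :=
        (integral_map hpair hψ.aestronglyMeasurable).symm
    _ = ∫ a, ∫ s, inner ℝ (u a) (φ a s) ∂D ∂(μ.map Z) := by rw [hmap, integral_prod _ hi]
    _ = 0 := by
        simp_rw [integral_inner (hint _), hzero, inner_zero_right, integral_zero]

end Oracle

/-! ### The past of the algorithm -/

section Past

variable {n d : ℕ} {Ω Ξ : Type*}

lemma Setup.iter_succ_x (A : Setup n d Ω Ξ) (ω : Ω) (k : ℕ) (i : Fin n) :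
    (A.iter ω (k + 1)).x i = ∑ j, A.R i j • ((A.iter ω k).x j - A.η • (A.iter ω k).v j) := rfl

lemma Setup.iter_succ_m (A : Setup n d Ω Ξ) (ω : Ω) (k : ℕ) (i : Fin n) :
    (A.iter ω (k + 1)).m i = (1 - A.lam) • (A.iter ω k).m i
      + A.lam • A.g i ((A.iter ω (k + 1)).x i) (A.ξ i (k + 1) ω) := rfl

lemma Setup.iter_succ_v (A : Setup n d Ω Ξ) (ω : Ω) (k : ℕ) (i : Fin n) :
    (A.iter ω (k + 1)).v i = ∑ j, A.C i j • (A.iter ω k).v j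
      + ((A.iter ω (k + 1)).m i - (A.iter ω k).m i) := rfl

/-- Only the samples up to time `k` have to be measurable, and the σ-algebra on `Ω` is arbitrary. It
can thus be the ambient one or `pastSamples`. -/
lemma Setup.measurable_iter [MeasurableSpace Ω] [MeasurableSpace Ξ] (A : Setup n d Ω Ξ)
    (hg : ∀ i, Measurable (Function.uncurry (A.g i))) (k : ℕ)
    (hξ : ∀ i s, s ≤ k → Measurable (A.ξ i s)) (i : Fin n) :
    Measurable (fun ω => (A.iter ω k).x i) ∧ Measurable (fun ω => (A.iter ω k).m i) ∧
      Measurable (fun ω => (A.iter ω k).v i) := by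
  induction k generalizing i with
  | zero => exact ⟨measurable_const, measurable_const, measurable_const⟩
  | succ k ih =>
    have ih' := ih fun i s hs => hξ i s (hs.trans (Nat.le_succ k))
    have hx : ∀ i, Measurable fun ω => (A.iter ω (k + 1)).x i := fun i => by
      simp only [A.iter_succ_x]
      refine Finset.measurable_fun_sum _ fun j _ => ?_
      exact ((ih' j).1.sub ((ih' j).2.2.const_smul A.η)).const_smul (A.R i j)
    have hm : ∀ i, Measurable fun ω => (A.iter ω (k + 1)).m i := fun i => by
      simp only [A.iter_succ_m]
      exact ((ih' i).2.1.const_smul (1 - A.lam)).add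
        (((hg i).comp ((hx i).prodMk (hξ i (k + 1) le_rfl))).const_smul A.lam)
    refine ⟨hx i, hm i, ?_⟩
    simp only [A.iter_succ_v]
    exact (Finset.measurable_fun_sum _ fun j _ => (ih' j).2.2.const_smul (A.C i j)).add
      ((hm i).sub (ih' i).2.1)

/-- The models are updated before the next sample is drawn, so `x` is one step ahead: at time `k +
1` it is determined by the samples up to `k`. -/
lemma Setup.measurable_x_succ [MeasurableSpace Ω] [MeasurableSpace Ξ] (A : Setup n d Ω Ξ)
    (hg : ∀ i, Measurable (Function.uncurry (A.g i))) (k : ℕ)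
    (hξ : ∀ i s, s ≤ k → Measurable (A.ξ i s)) (i : Fin n) :
    Measurable (fun ω => (A.iter ω (k + 1)).x i) := by
  simp only [A.iter_succ_x]
  refine Finset.measurable_fun_sum _ fun j _ => ?_
  exact ((A.measurable_iter hg k hξ j).1.sub
      ((A.measurable_iter hg k hξ j).2.2.const_smul A.η)).const_smul (A.R i j)

/-- The information carried by the samples up to iteration `k`. -/
@[reducible]
def pastSamples [mΞ : MeasurableSpace Ξ] (ξ : Fin n → ℕ → Ω → Ξ) (k : ℕ) : MeasurableSpace Ω :=
  ⨆ q ∈ {q : Fin n × ℕ | q.2 ≤ k}, mΞ.comap (ξ q.1 q.2)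

lemma measurable_pastSamples [mΞ : MeasurableSpace Ξ] (ξ : Fin n → ℕ → Ω → Ξ) {k s : ℕ}
    (hs : s ≤ k) (i : Fin n) : Measurable[pastSamples ξ k] (ξ i s) := by
  have h : mΞ.comap (ξ i s) ≤ pastSamples ξ k :=
    le_iSup₂_of_le (f := fun (q : Fin n × ℕ) (_ : q ∈ {q : Fin n × ℕ | q.2 ≤ k}) =>
      mΞ.comap (ξ q.1 q.2)) (i, s) hs le_rfl
  exact (comap_measurable (ξ i s)).mono h le_rfl

/-- The past and the new sample belong to disjoint index sets of an independent family. -/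
lemma SamplingAssumption.indepFun_past [MeasurableSpace Ω] [mΞ : MeasurableSpace Ξ]
    {μ : Measure Ω} {D : Fin n → Measure Ξ} {ξ : Fin n → ℕ → Ω → Ξ}
    (h : SamplingAssumption μ D ξ) {α : Type*} [MeasurableSpace α] {Z : Ω → α} {k : ℕ}
    (hZ : Measurable[pastSamples ξ k] Z) (i : Fin n) : IndepFun Z (ξ i (k + 1)) μ := by
  have hdisj : Disjoint {q : Fin n × ℕ | q.2 ≤ k} {(i, k + 1)} := by
    rw [Set.disjoint_singleton_right]; simp
  have hI := indep_iSup_of_disjoint (fun q : Fin n × ℕ => (h.measurable q.1 q.2).comap_le)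
    h.indep.iIndep hdisj
  rw [iSup_singleton] at hI
  rw [IndepFun_iff_Indep]
  exact indep_of_indep_of_le_left hI hZ.comap_le

end Past

/-! ### Expectations along the algorithm -/

section Expectation

variable {n d : ℕ} {Ω Ξ : Type*}

/-- The gradient noise. At the start, where no gradient is sampled, it cancels the gradient. -/
def Setup.noise (A : Setup n d Ω Ξ) (f : Fin n → Vec d → ℝ) (k : ℕ) (ω : Ω) (i : Fin n) : Vec d :=
  match k with
  | 0 => -gradient (f i) A.x₀
  | k + 1 => A.g i ((A.iter ω (k + 1)).x i) (A.ξ i (k + 1) ω)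
      - gradient (f i) ((A.iter ω (k + 1)).x i)

lemma Setup.isTrajectory (A : Setup n d Ω Ξ) (f : Fin n → Vec d → ℝ) (ω : Ω) :
    IsTrajectory A.R A.C A.η A.lam (fun i => gradient (f i)) A.x₀ (fun k => (A.iter ω k).x)
      (fun k => (A.iter ω k).m) (fun k => (A.iter ω k).v) (fun k => A.noise f k ω) where
  x_zero := rfl
  m_zero := rfl
  v_zero := rfl
  e_zero := rfl
  x_succ _ := rfl
  m_succ k := by
    ext1 i
    simp [A.iter_succ_m, Setup.noise, smul_sub]
  v_succ _ := rfl

variable [MeasurableSpace Ω] [MeasurableSpace Ξ] {μ : Measure Ω} [IsProbabilityMeasure μ]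
  {f : Fin n → Vec d → ℝ} {L σ : ℝ} {D : Fin n → Measure Ξ}

lemma ObjectiveAssumption.memLp_gradient (hf : ObjectiveAssumption f L) (hL : 0 ≤ L) (i : Fin n)
    {X : Ω → Vec d} (hX : MemLp X 2 μ) : MemLp (fun ω => gradient (f i) (X ω)) 2 μ := by
  have h1 : MemLp (fun ω => ‖gradient (f i) 0‖ + L * ‖X ω‖) 2 μ :=
    (memLp_const ‖gradient (f i) 0‖).add (hX.norm.const_mul L)
  refine h1.of_le ((hf.continuous_gradient hL i).comp_aestronglyMeasurable hX.1)
    (ae_of_all _ fun ω => ?_)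
  have h2 := hf.lipschitz i (X ω) 0
  rw [sub_zero] at h2
  have h3 := norm_sub_norm_le (gradient (f i) (X ω)) (gradient (f i) 0)
  rw [Real.norm_eq_abs]
  exact le_trans (by linarith) (le_abs_self _)

lemma memLp_avg {μ : Measure Ω} {X : Ω → Fin n → Vec d} (hX : ∀ i, MemLp (fun ω => X ω i) 2 μ) :
    MemLp (fun ω => avg (X ω)) 2 μ :=
  (memLp_finsetSum _ fun i _ => hX i).const_smul (1 / (n : ℝ))

/-! ### Square integrability and centred noise along a run -/

section Run

variable {A : Setup n d Ω Ξ}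

lemma OracleAssumption.measurable_sub (hf : ObjectiveAssumption f L) (hL : 0 ≤ L)
    {g : Fin n → Vec d → Ξ → Vec d} (ho : OracleAssumption f D g σ) (i : Fin n) :
    Measurable (Function.uncurry fun (x : Vec d) s => g i x s - gradient (f i) x) :=
  (ho.measurable i).sub ((hf.continuous_gradient hL i).measurable.comp measurable_fst)

lemma SamplingAssumption.isProbabilityMeasure {ξ : Fin n → ℕ → Ω → Ξ}
    (hs : SamplingAssumption μ D ξ) (i : Fin n) : IsProbabilityMeasure (D i) :=
  hs.law i 0 ▸ Measure.isProbabilityMeasure_map (hs.measurable i 0).aemeasurable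

/-- The variance bound is uniform in the point, so measurability of the iterate is enough. This lets
the induction in `Setup.memLp_iter` use the noise bound without circularity. -/
lemma Setup.memLp_noise_succ (hf : ObjectiveAssumption f L) (hL : 0 ≤ L)
    (ho : OracleAssumption f D A.g σ) (hs : SamplingAssumption μ D A.ξ) (k : ℕ) (i : Fin n) :
    MemLp (fun ω => A.noise f (k + 1) ω i) 2 μ ∧
      ∫ ω, ‖A.noise f (k + 1) ω i‖ ^ 2 ∂μ ≤ σ ^ 2 := by
  have := hs.isProbabilityMeasure i
  refine memLp_of_indepFun (ho.measurable_sub hf hL i)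
    (fun x => (ho.memLp i x).sub (memLp_const _)) (ho.variance_le i)
    (A.measurable_x_succ ho.measurable k (fun j s _ => hs.measurable j s) i)
    (hs.measurable i (k + 1)) (hs.law i (k + 1)) (hs.indepFun_past ?_ i)
  exact @Setup.measurable_x_succ n d Ω Ξ (pastSamples A.ξ k) _ A ho.measurable k
    (fun j s hsk => measurable_pastSamples A.ξ hsk j) i

lemma Setup.memLp_iter (hf : ObjectiveAssumption f L) (hL : 0 ≤ L)
    (ho : OracleAssumption f D A.g σ) (hs : SamplingAssumption μ D A.ξ) (k : ℕ) (i : Fin n) :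
    MemLp (fun ω => (A.iter ω k).x i) 2 μ ∧ MemLp (fun ω => (A.iter ω k).m i) 2 μ ∧
      MemLp (fun ω => (A.iter ω k).v i) 2 μ := by
  induction k generalizing i with
  | zero => exact ⟨memLp_const _, memLp_const _, memLp_const _⟩
  | succ k ih =>
    have hx : ∀ i, MemLp (fun ω => (A.iter ω (k + 1)).x i) 2 μ := fun i => by
      simp only [A.iter_succ_x]
      refine memLp_finsetSum _ fun j _ => ?_
      exact ((ih j).1.sub ((ih j).2.2.const_smul A.η)).const_smul (A.R i j)
    have hm : ∀ i, MemLp (fun ω => (A.iter ω (k + 1)).m i) 2 μ := fun i => by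
      have e : (fun ω => (A.iter ω (k + 1)).m i) = fun ω => (1 - A.lam) • (A.iter ω k).m i
          + A.lam • (A.noise f (k + 1) ω i + gradient (f i) ((A.iter ω (k + 1)).x i)) := by
        ext1 ω
        simp [A.iter_succ_m, Setup.noise]
      rw [e]
      exact ((ih i).2.1.const_smul (1 - A.lam)).add
        (((Setup.memLp_noise_succ hf hL ho hs k i).1.add
          (hf.memLp_gradient hL i (hx i))).const_smul A.lam)
    refine ⟨hx i, hm i, ?_⟩
    simp only [A.iter_succ_v]
    exact (memLp_finsetSum _ fun j _ => (ih j).2.2.const_smul (A.C i j)).add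
      ((hm i).sub (ih i).2.1)

lemma Setup.memLp_xbar (hf : ObjectiveAssumption f L) (hL : 0 ≤ L)
    (ho : OracleAssumption f D A.g σ) (hs : SamplingAssumption μ D A.ξ) (πR : Fin n → ℝ) (k : ℕ) :
    MemLp (fun ω => ∑ i, πR i • (A.iter ω k).x i) 2 μ :=
  memLp_finsetSum _ fun i _ => (Setup.memLp_iter hf hL ho hs k i).1.const_smul (πR i)

lemma Setup.memLp_gradient_xbar (hf : ObjectiveAssumption f L) (hL : 0 ≤ L)
    (ho : OracleAssumption f D A.g σ) (hs : SamplingAssumption μ D A.ξ) (πR : Fin n → ℝ) (k : ℕ) :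
    MemLp (fun ω => avg fun i => gradient (f i) (∑ j, πR j • (A.iter ω k).x j)) 2 μ :=
  memLp_avg fun i => hf.memLp_gradient hL i (Setup.memLp_xbar hf hL ho hs πR k)

lemma Setup.memLp_gradient_virtualSeq (hf : ObjectiveAssumption f L) (hL : 0 ≤ L)
    (ho : OracleAssumption f D A.g σ) (hs : SamplingAssumption μ D A.ξ) (πR πC : Fin n → ℝ)
    (k : ℕ) :
    MemLp (fun ω => avg fun i => gradient (f i) (virtualSeq πR πC A.η A.lam
      (fun k => (A.iter ω k).x) (fun k => (A.iter ω k).m) k)) 2 μ := by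
  have hm : MemLp (fun ω => prevAvg (fun k => (A.iter ω k).m) k) 2 μ := by
    cases k with
    | zero => exact memLp_const _
    | succ k => exact memLp_avg fun i => (Setup.memLp_iter hf hL ho hs k i).2.1
  exact memLp_avg fun i => hf.memLp_gradient hL i
    ((Setup.memLp_xbar hf hL ho hs πR k).sub
      (hm.const_smul (A.η * cPi πR πC * (1 - A.lam) / A.lam)))

/-- The virtual point at time `k + 1` uses the momentum of time `k`; this delay makes it independent
of the samples drawn at `k + 1`. -/
lemma Setup.measurable_gradient_virtualSeq {Ω : Type*} [MeasurableSpace Ω] (A : Setup n d Ω Ξ)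
    (hf : ObjectiveAssumption f L) (hL : 0 ≤ L)
    (hg : ∀ i, Measurable (Function.uncurry (A.g i))) (πR πC : Fin n → ℝ) (k : ℕ)
    (hξ : ∀ i s, s ≤ k → Measurable (A.ξ i s)) :
    Measurable (fun ω => avg fun i => gradient (f i) (virtualSeq πR πC A.η A.lam
      (fun k => (A.iter ω k).x) (fun k => (A.iter ω k).m) (k + 1))) := by
  have hz : Measurable fun ω => virtualSeq πR πC A.η A.lam
      (fun k => (A.iter ω k).x) (fun k => (A.iter ω k).m) (k + 1) := by
    have hm : Measurable fun ω => avg (A.iter ω k).m :=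
      (Finset.measurable_fun_sum _ fun i _ => (A.measurable_iter hg k hξ i).2.1).const_smul
        (1 / (n : ℝ))
    exact (Finset.measurable_fun_sum _ fun i _ =>
      (A.measurable_x_succ hg k hξ i).const_smul (πR i)).sub
        (hm.const_smul (A.η * cPi πR πC * (1 - A.lam) / A.lam))
  exact (Finset.measurable_fun_sum _ fun i _ =>
    (hf.continuous_gradient hL i).measurable.comp hz).const_smul (1 / (n : ℝ))

lemma Setup.integral_inner_noise (hf : ObjectiveAssumption f L) (hL : 0 ≤ L)
    (ho : OracleAssumption f D A.g σ) (hs : SamplingAssumption μ D A.ξ) (πR πC : Fin n → ℝ)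
    (k : ℕ) (i : Fin n) :
    ∫ ω, inner ℝ (avg fun i => gradient (f i) (virtualSeq πR πC A.η A.lam
      (fun k => (A.iter ω k).x) (fun k => (A.iter ω k).m) (k + 1)))
      (A.noise f (k + 1) ω i) ∂μ = 0 := by
  have := hs.isProbabilityMeasure i
  set G : Ω → Vec d := fun ω => avg fun i => gradient (f i) (virtualSeq πR πC A.η A.lam
      (fun k => (A.iter ω k).x) (fun k => (A.iter ω k).m) (k + 1)) with hG
  -- The gradient at the virtual point and the query point of agent `i` are both functions of the
  -- past, so conditioning is on the pair.
  set Z : Ω → Vec d × Vec d := fun ω => (G ω, (A.iter ω (k + 1)).x i) with hZ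
  have hZm : Measurable Z :=
    (A.measurable_gradient_virtualSeq hf hL ho.measurable πR πC k
      (fun j s _ => hs.measurable j s)).prodMk
      (A.measurable_x_succ ho.measurable k (fun j s _ => hs.measurable j s) i)
  have hZp : Measurable[pastSamples A.ξ k] Z :=
    Measurable.prodMk
      (@Setup.measurable_gradient_virtualSeq n d Ξ _ f L Ω (pastSamples A.ξ k) A hf hL
        ho.measurable πR πC k (fun j s hsk => measurable_pastSamples A.ξ hsk j))
      (@Setup.measurable_x_succ n d Ω Ξ (pastSamples A.ξ k) _ A ho.measurable k
        (fun j s hsk => measurable_pastSamples A.ξ hsk j) i)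
  refine integral_inner_eq_zero_of_indepFun (E := Vec d) (Z := Z) (W := A.ξ i (k + 1)) (D := D i)
    (φ := fun (a : Vec d × Vec d) s => A.g i a.2 s - gradient (f i) a.2) (u := Prod.fst)
    ?_ (fun a => ?_) (fun a => ?_) hZm (hs.measurable i (k + 1)) (hs.law i (k + 1))
    (hs.indepFun_past hZp i) measurable_fst
    (Setup.memLp_gradient_virtualSeq hf hL ho hs πR πC (k + 1))
    (Setup.memLp_noise_succ hf hL ho hs k i).1
  · exact (ho.measurable_sub hf hL i).comp
      ((measurable_snd.comp measurable_fst).prodMk measurable_snd)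
  · exact ((ho.memLp i a.2).integrable one_le_two).sub (integrable_const _)
  · rw [integral_sub ((ho.memLp i a.2).integrable one_le_two) (integrable_const _),
      ho.unbiased i a.2]
    simp

lemma inner_avg_right (u : Vec d) (X : Fin n → Vec d) :
    inner ℝ u (avg X) = (1 / (n : ℝ)) * ∑ i, inner ℝ u (X i) := by
  rw [avg, inner_smul_right, inner_sum]

lemma norm_sq_le_sum_norm_sq (X : Fin n → Vec d) : ‖X‖ ^ 2 ≤ ∑ i, ‖X i‖ ^ 2 := by
  have h0 : 0 ≤ ∑ i, ‖X i‖ ^ 2 := Finset.sum_nonneg fun _ _ => sq_nonneg _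
  have : ‖X‖ ≤ √(∑ i, ‖X i‖ ^ 2) := by
    refine (pi_norm_le_iff_of_nonneg (Real.sqrt_nonneg _)).2 fun i => Real.le_sqrt_of_sq_le ?_
    exact Finset.single_le_sum (f := fun i => ‖X i‖ ^ 2) (fun _ _ => sq_nonneg _)
      (Finset.mem_univ i)
  calc ‖X‖ ^ 2 ≤ √(∑ i, ‖X i‖ ^ 2) ^ 2 := by gcongr
    _ = _ := Real.sq_sqrt h0

/-- Taking expectations in a pathwise bound. -/
lemma Setup.sum_integral_le_of_pathwise (hf : ObjectiveAssumption f L) (hL : 0 ≤ L)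
    (ho : OracleAssumption f D A.g σ) (hs : SamplingAssumption μ D A.ξ) {πR : Fin n → ℝ}
    (hπ : πR ∈ stdSimplex ℝ (Fin n)) (πC : Fin n → ℝ) {P B : ℝ} (hB : 0 ≤ B) (T : ℕ)
    (hpath : ∀ ω, ∑ k ∈ Finset.range T,
        ‖avg fun i => gradient (f i) (∑ j, πR j • (A.iter ω k).x j)‖ ^ 2 ≤
      4 * (P - 4 * ∑ k ∈ Finset.range T,
          inner ℝ (avg fun i => gradient (f i) (virtualSeq πR πC A.η A.lam
            (fun k => (A.iter ω k).x) (fun k => (A.iter ω k).m) k)) (avg (A.noise f k ω)))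
        + B * (‖fun i => gradient (f i) A.x₀‖ ^ 2
          + A.lam ^ 2 * ∑ k ∈ Finset.range T, ‖A.noise f (k + 1) ω‖ ^ 2)) :
    ∑ k ∈ Finset.range T,
        ∫ ω, ‖avg fun i => gradient (f i) (∑ j, πR j • (A.iter ω k).x j)‖ ^ 2 ∂μ ≤
      4 * P + (16 + B) * ∑ i, ‖gradient (f i) A.x₀‖ ^ 2 + B * A.lam ^ 2 * (T * (n * σ ^ 2)) := by
  set z : ℕ → Ω → Vec d := fun k ω => virtualSeq πR πC A.η A.lam
    (fun k => (A.iter ω k).x) (fun k => (A.iter ω k).m) k with hz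
  set S₀ := ∑ i, ‖gradient (f i) A.x₀‖ ^ 2 with hS₀
  have hnoise : ∀ k i, MemLp (fun ω => A.noise f k ω i) 2 μ := fun k i => by
    cases k with
    | zero => exact memLp_const _
    | succ k => exact (Setup.memLp_noise_succ hf hL ho hs k i).1
  have hI : ∀ k, Integrable (fun ω => (inner ℝ (avg fun i => gradient (f i) (z k ω))
      (avg (A.noise f k ω)) : ℝ)) μ := fun k =>
    integrable_inner_of_memLp (Setup.memLp_gradient_virtualSeq hf hL ho hs πR πC k)
      (memLp_avg (hnoise k))
  have hN : ∀ k i, Integrable (fun ω => ‖A.noise f k ω i‖ ^ 2) μ := fun k i =>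
    (memLp_two_iff_integrable_sq_norm (hnoise k i).1).1 (hnoise k i)
  have hGi : ∀ k, Integrable
      (fun ω => ‖avg fun i => gradient (f i) (∑ j, πR j • (A.iter ω k).x j)‖ ^ 2) μ := fun k => by
    have h := Setup.memLp_gradient_xbar hf hL ho hs πR k
    exact (memLp_two_iff_integrable_sq_norm h.1).1 h
  have hI0 : ∀ k, ∫ ω, (inner ℝ (avg fun i => gradient (f i) (z (k + 1) ω))
      (avg (A.noise f (k + 1) ω)) : ℝ) ∂μ = 0 := fun k => by
    simp_rw [inner_avg_right]
    rw [integral_const_mul, integral_finsetSum _ fun i _ => integrable_inner_of_memLp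
      (Setup.memLp_gradient_virtualSeq hf hL ho hs πR πC (k + 1)) (hnoise (k + 1) i)]
    rw [Finset.sum_eq_zero fun i _ => Setup.integral_inner_noise hf hL ho hs πR πC k i, mul_zero]
  -- Only the term `k = 0` survives. There the artificial noise is minus the gradient, so the term
  -- is `-‖∇F(x₀)‖²`; with the factor `4 * 4` this produces the `16` in the bound.
  have hI1 : -S₀ ≤ ∑ k ∈ Finset.range T, ∫ ω, (inner ℝ (avg fun i => gradient (f i) (z k ω))
      (avg (A.noise f k ω)) : ℝ) ∂μ := by
    have hS : 0 ≤ S₀ := Finset.sum_nonneg fun _ _ => sq_nonneg _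
    cases T with
    | zero => simpa using hS
    | succ T =>
      rw [Finset.sum_range_succ', Finset.sum_eq_zero fun k _ => hI0 k, zero_add]
      have hle : ∀ ω, -S₀ ≤ (inner ℝ (avg fun i => gradient (f i) (z 0 ω))
          (avg (A.noise f 0 ω)) : ℝ) := fun ω => by
        have h1 : z 0 ω = A.x₀ := (A.isTrajectory f ω).virtualSeq_zero hπ
        have h2 : A.noise f 0 ω = -fun i => gradient (f i) A.x₀ := rfl
        rw [h1, h2, avg_neg, inner_neg_right, real_inner_self_eq_norm_sq, neg_le_neg_iff]
        exact (pow_le_pow_left₀ (norm_nonneg _) (norm_avg_le _) 2).trans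
          (norm_sq_le_sum_norm_sq _)
      have := integral_mono (integrable_const (-S₀)) (hI 0) hle
      simpa using this
  have hle : ∀ ω, ∑ k ∈ Finset.range T,
        ‖avg fun i => gradient (f i) (∑ j, πR j • (A.iter ω k).x j)‖ ^ 2 ≤
      (4 * P + B * S₀) - 16 * ∑ k ∈ Finset.range T,
          inner ℝ (avg fun i => gradient (f i) (z k ω)) (avg (A.noise f k ω))
        + B * A.lam ^ 2 * ∑ k ∈ Finset.range T, ∑ i, ‖A.noise f (k + 1) ω i‖ ^ 2 := fun ω => by
    have h1 : B * ‖fun i => gradient (f i) A.x₀‖ ^ 2 ≤ B * S₀ := by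
      gcongr; exact norm_sq_le_sum_norm_sq _
    have h2 : B * A.lam ^ 2 * ∑ k ∈ Finset.range T, ‖A.noise f (k + 1) ω‖ ^ 2 ≤
        B * A.lam ^ 2 * ∑ k ∈ Finset.range T, ∑ i, ‖A.noise f (k + 1) ω i‖ ^ 2 := by
      gcongr with k _
      exact norm_sq_le_sum_norm_sq _
    have h3 := hpath ω
    linarith
  have hi1 : Integrable (fun ω => 16 * ∑ k ∈ Finset.range T,
      (inner ℝ (avg fun i => gradient (f i) (z k ω)) (avg (A.noise f k ω)) : ℝ)) μ :=
    (integrable_finsetSum _ fun k _ => hI k).const_mul 16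
  have hi2 : Integrable (fun ω => B * A.lam ^ 2 *
      ∑ k ∈ Finset.range T, ∑ i, ‖A.noise f (k + 1) ω i‖ ^ 2) μ :=
    (integrable_finsetSum _ fun k _ => integrable_finsetSum _ fun i _ => hN (k + 1) i).const_mul _
  have hint := integral_mono (integrable_finsetSum _ fun k _ => hGi k)
    (((integrable_const (4 * P + B * S₀)).sub hi1).add hi2) hle
  have hnoise2 : ∑ k ∈ Finset.range T, ∑ i, ∫ ω, ‖A.noise f (k + 1) ω i‖ ^ 2 ∂μ ≤
      T * (n * σ ^ 2) := by
    calc _ ≤ ∑ _k ∈ Finset.range T, ∑ _i : Fin n, σ ^ 2 :=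
          Finset.sum_le_sum fun k _ => Finset.sum_le_sum fun i _ =>
            (Setup.memLp_noise_succ hf hL ho hs k i).2
      _ = _ := by simp
  rw [integral_add' ((integrable_const _).sub hi1) hi2, integral_sub' (integrable_const _) hi1,
    integral_const_mul, integral_const_mul, integral_finsetSum _ fun k _ => hI k,
    integral_finsetSum _ fun k _ => hGi k,
    integral_finsetSum _ fun k _ => integrable_finsetSum _ fun i _ => hN (k + 1) i,
    Finset.sum_congr rfl fun k _ => integral_finsetSum _ fun i _ => hN (k + 1) i] at hint
  simp only [integral_const, probReal_univ, one_smul] at hint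
  have h4 := mul_le_mul_of_nonneg_left hnoise2 (show 0 ≤ B * A.lam ^ 2 by positivity)
  linarith

end Run

end Expectation

/-! ### The Lyapunov function at the start and at the end -/

section Lyapunov

variable {n d : ℕ} {Ω Ξ : Type*} [MeasurableSpace Ω] {μ : Measure Ω} {f : Fin n → Vec d → ℝ}
  {L : ℝ}

lemma weightedNormSq_nonneg (S : Matrix (Fin n) (Fin n) ℝ) (X : Fin n → Vec d) :
    0 ≤ weightedNormSq S X :=
  Finset.sum_nonneg fun _ _ => sq_nonneg _

lemma weightedNormSq_zero (S : Matrix (Fin n) (Fin n) ℝ) :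
    weightedNormSq S (fun _ => (0 : Vec d)) = 0 := by
  have : (fun _ : Fin n => (0 : ℝ)) = 0 := rfl
  simp [weightedNormSq, this]

lemma Setup.lyapunov_nonneg (A : Setup n d Ω Ξ) (hf : ObjectiveAssumption f L)
    (πR πC : Fin n → ℝ) (SR SC : Matrix (Fin n) (Fin n) ℝ) {p : Fin 4 → ℝ} (hp : ∀ i, 0 < p i)
    (k : ℕ) : 0 ≤ A.lyapunov μ f πR πC SR SC p k := by
  refine add_nonneg (integral_nonneg fun ω => sub_nonneg.2 (hf.optValue_le _))
    (Finset.sum_nonneg fun j _ => mul_nonneg (hp j).le ?_)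
  fin_cases j
  · exact integral_nonneg fun ω => weightedNormSq_nonneg _ _
  · exact integral_nonneg fun ω => weightedNormSq_nonneg _ _
  · exact integral_nonneg fun ω => Finset.sum_nonneg fun _ _ => sq_nonneg _
  · exact integral_nonneg fun ω => sq_nonneg _

/-- Equal starting points and zero momenta and trackers annihilate every error but the momentum
error, so the norms `SR`, `SC` and the other weights drop out. -/
lemma Setup.lyapunov_zero [IsProbabilityMeasure μ] (A : Setup n d Ω Ξ) {πR : Fin n → ℝ}
    (hπ : πR ∈ stdSimplex ℝ (Fin n)) (πC : Fin n → ℝ) (SR SC : Matrix (Fin n) (Fin n) ℝ)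
    (p : Fin 4 → ℝ) :
    A.lyapunov μ f πR πC SR SC p 0 =
      objective f A.x₀ - optValue f + p 2 * ∑ i, ‖gradient (f i) A.x₀‖ ^ 2 := by
  have hx : ∀ ω i, (A.iter ω 0).x i = A.x₀ := fun _ _ => rfl
  have hm : ∀ ω i, (A.iter ω 0).m i = 0 := fun _ _ => rfl
  have hv : ∀ ω i, (A.iter ω 0).v i = 0 := fun _ _ => rfl
  have hz : ∀ ω, A.ztilde πR πC 0 ω = A.x₀ := fun ω => by
    simp [Setup.ztilde, Setup.xbar, Setup.mbarPrev, hx, ← Finset.sum_smul, hπ.2]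
  have hxs : ∑ j, πR j • A.x₀ = A.x₀ := by rw [← Finset.sum_smul, hπ.2, one_smul]
  simp [Setup.lyapunov, Setup.errorVec, dotProduct, Fin.sum_univ_four, hz, hx, hm, hv, hxs,
    weightedNormSq_zero, Setup.mbarPrev]

end Lyapunov

/-! ### The coupling of step size, momentum and horizon -/

section Coupling

variable {n T : ℕ} {a₁ a₂ b₁ b₂ lam η : ℝ}

lemma rpow_quarter_sq {t : ℝ} (ht : 0 ≤ t) : (t ^ (1 / 4 : ℝ)) ^ 2 = √t := by
  rw [Real.sqrt_eq_rpow, ← Real.rpow_natCast, ← Real.rpow_mul ht]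
  norm_num

lemma Coupled.lam_pos (h : Coupled n T a₁ a₂ b₁ b₂ lam η) (ha₁ : 0 < a₁) (hn : 0 < n)
    (hT : 1 ≤ T) : 0 < lam := by
  have : (0 : ℝ) < n / T := by positivity
  exact lt_of_lt_of_le (by positivity) h.1

lemma Coupled.le_lam_sq (h : Coupled n T a₁ a₂ b₁ b₂ lam η) (ha₁ : 0 < a₁) :
    a₁ ^ 2 * √((n : ℝ) / T) ≤ lam ^ 2 := by
  rw [← rpow_quarter_sq (by positivity), ← mul_pow]
  exact pow_le_pow_left₀ (by positivity) h.1 2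

lemma Coupled.lam_sq_le (h : Coupled n T a₁ a₂ b₁ b₂ lam η) (hl : 0 < lam) :
    lam ^ 2 ≤ a₂ ^ 2 * √((n : ℝ) / T) := by
  rw [← rpow_quarter_sq (by positivity), ← mul_pow]
  exact pow_le_pow_left₀ hl.le h.2.1 2

lemma Coupled.le_step (h : Coupled n T a₁ a₂ b₁ b₂ lam η) (ha₁ : 0 < a₁) (hb₁ : 0 < b₁) :
    b₁ * a₁ ^ 2 * √((n : ℝ) / T) ≤ η :=
  le_trans (by rw [mul_assoc]; exact mul_le_mul_of_nonneg_left (h.le_lam_sq ha₁) hb₁.le) h.2.2.1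

lemma Coupled.step_le (h : Coupled n T a₁ a₂ b₁ b₂ lam η) (hl : 0 < lam) (hb₂ : 0 < b₂) :
    η ≤ b₂ * a₂ ^ 2 * √((n : ℝ) / T) :=
  h.2.2.2.trans (by rw [mul_assoc]; exact mul_le_mul_of_nonneg_left (h.lam_sq_le hl) hb₂.le)

lemma mul_sqrt_div (n : ℕ) (hT : 1 ≤ T) : (T : ℝ) * √((n : ℝ) / T) = √((n : ℝ) * T) := by
  have hT' : (0 : ℝ) < T := by exact_mod_cast hT
  have h : (n : ℝ) * T = T ^ 2 * (n / T) := by field_simp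
  rw [h, Real.sqrt_mul (by positivity), Real.sqrt_sq hT'.le]

end Coupling

/-- The averaged bound in terms of the quantities that enter the Lyapunov function. -/
lemma average_le_of_sum_le {T n : ℕ} (hT : 1 ≤ T) (hn : 0 < n)
    {S Δ G p₂ κ η c cp l₂ σ β α : ℝ} (hκ : 0 < κ) (hβ : 0 < β) (hcp : 0 < cp)
    (hη : β * √((n : ℝ) / T) ≤ η) (hl : l₂ ≤ α * √((n : ℝ) / T)) (hΔ : 0 ≤ Δ) (hG : 0 ≤ G)
    (hp : κ * η ≤ p₂) (hc : 1 ≤ c)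
    (hS : S ≤ 4 * (4 / (cp * η) * Δ) + (16 + 48 * c ^ 4) * G
      + 48 * c ^ 4 * l₂ * (T * (n * σ ^ 2))) :
    1 / (T : ℝ) * S ≤ (16 / cp + 64 * c ^ 4 / κ) / β * ((Δ + p₂ * G) / √((n : ℝ) * T))
      + 48 * c ^ 4 * α * n * (σ ^ 2 * √((n : ℝ) / T)) := by
  have hT' : (0 : ℝ) < T := by exact_mod_cast hT
  have hn' : (0 : ℝ) < n := by exact_mod_cast hn
  set r := √((n : ℝ) / T) with hr
  have hr0 : 0 < r := Real.sqrt_pos.2 (by positivity)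
  have hη0 : 0 < η := lt_of_lt_of_le (by positivity) hη
  have hq : √((n : ℝ) * T) = T * r := (mul_sqrt_div n hT).symm
  have hc4 : 1 ≤ c ^ 4 := one_le_pow₀ hc
  -- The initial gradients appear without the factor `1 / η` of the objective gap. The lower bound
  -- on `p₂` rewrites them as a Lyapunov term with that factor.
  have hκG : G ≤ p₂ * G / (κ * η) := by
    rw [le_div_iff₀ (by positivity)]
    nlinarith
  have h1 : 4 * (4 / (cp * η) * Δ) + (16 + 48 * c ^ 4) * G ≤
      (16 / cp + 64 * c ^ 4 / κ) * (Δ + p₂ * G) / η := by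
    have hp₂ : 0 ≤ p₂ := le_trans (by positivity) hp
    calc _ ≤ 16 / cp * Δ / η + 64 * c ^ 4 * (p₂ * G / (κ * η)) := by
          have : (16 + 48 * c ^ 4) * G ≤ 64 * c ^ 4 * (p₂ * G / (κ * η)) := by
            gcongr; linarith
          have e : 4 * (4 / (cp * η) * Δ) = 16 / cp * Δ / η := by field_simp; ring
          linarith
      _ = (16 / cp * Δ + 64 * c ^ 4 / κ * (p₂ * G)) / η := by field_simp
      _ ≤ (16 / cp * Δ + 64 * c ^ 4 / κ * (p₂ * G)
          + (16 / cp * (p₂ * G) + 64 * c ^ 4 / κ * Δ)) / η := by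
          have : 0 ≤ 16 / cp * (p₂ * G) + 64 * c ^ 4 / κ * Δ := by positivity
          exact div_le_div_of_nonneg_right (by linarith) hη0.le
      _ = _ := by ring
  have hp₂ : 0 ≤ p₂ := le_trans (by positivity) hp
  have h2 : (16 / cp + 64 * c ^ 4 / κ) * (Δ + p₂ * G) / η ≤
      (16 / cp + 64 * c ^ 4 / κ) * (Δ + p₂ * G) / (β * r) := by gcongr
  have h3 : 48 * c ^ 4 * l₂ * (T * (n * σ ^ 2)) ≤ 48 * c ^ 4 * (α * r) * (T * (n * σ ^ 2)) := by
    gcongr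
  have h4 : S ≤ (16 / cp + 64 * c ^ 4 / κ) * (Δ + p₂ * G) / (β * r)
      + 48 * c ^ 4 * (α * r) * (T * (n * σ ^ 2)) := by linarith
  calc 1 / (T : ℝ) * S ≤ 1 / (T : ℝ) * ((16 / cp + 64 * c ^ 4 / κ) * (Δ + p₂ * G) / (β * r)
      + 48 * c ^ 4 * (α * r) * (T * (n * σ ^ 2))) := by gcongr
    _ = _ := by
      rw [hq, mul_add]
      congr 1 <;> field_simp

end SMTPP

end

/-! ### The corollary -/

theorem corollary1 {n : ℕ} (GR GC : Digraph (Fin n)) (R C : Matrix (Fin n) (Fin n) ℝ)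
    (hnet : NetworkAssumption GR GC R C)
    (πR πC : Fin n → ℝ) (hπR : IsLeftStationary R πR) (hπC : IsRightStationary C πC)
    (L : ℝ) (a₁ a₂ b₁ b₂ κ : ℝ)
    (ha₁ : 0 < a₁) (ha₂ : 0 < a₂) (hb₁ : 0 < b₁) (hb₂ : 0 < b₂) (hκ : 0 < κ) :
    -- the constants depend only on the network, on `L` and on the constants of the coupling
    ∃ lamMax ∈ Set.Ioo (0 : ℝ) 1, ∃ K : ℝ, 0 < K ∧
      ∀ (d : ℕ) (f : Fin n → Vec d → ℝ), ObjectiveAssumption f L →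
      ∀ (Ω Ξ : Type*) [MeasurableSpace Ω] [MeasurableSpace Ξ]
        (μ : Measure Ω) [IsProbabilityMeasure μ] (D : Fin n → Measure Ξ)
        (g : Fin n → Vec d → Ξ → Vec d) (σ : ℝ) (ξ : Fin n → ℕ → Ω → Ξ) (x₀ : Vec d),
        OracleAssumption f D g σ → SamplingAssumption μ D ξ →
        -- the bound for every horizon
        (∀ (T : ℕ) (lam η : ℝ), 1 ≤ T → lam ≤ lamMax → Coupled n T a₁ a₂ b₁ b₂ lam η →
          let A : Setup n d Ω Ξ := { R := R, C := C, g := g, ξ := ξ, x₀ := x₀, η := η, lam := lam }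
          -- the resulting order of the step size
          (b₁ * a₁ ^ 2 * √((n : ℝ) / T) ≤ η ∧ η ≤ b₂ * a₂ ^ 2 * √((n : ℝ) / T)) ∧
          (∀ k, Integrable (fun ω => ‖gradient (objective f) (A.xbar πR k ω)‖ ^ 2) μ) ∧
          ∀ (SR SC : Matrix (Fin n) (Fin n) ℝ) (p : Fin 4 → ℝ), IsUnit SR → IsUnit SC →
            (∀ i, 0 < p i) → κ * η ≤ p 2 →
            A.avgGradSq μ f πR T ≤
                K * (A.lyapunov μ f πR πC SR SC p 0 / √((n : ℝ) * T))
                  + K * (σ ^ 2 * √((n : ℝ) / T)) ∧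
              0 ≤ A.lyapunov μ f πR πC SR SC p T ∧
              A.lyapunov μ f πR πC SR SC p 0 =
                objective f x₀ - optValue f + p 2 * ∑ i, ‖gradient (f i) x₀‖ ^ 2) ∧
        -- the error floor vanishes as the horizon grows
        (∀ lam η : ℕ → ℝ, (∀ᶠ T in atTop, Coupled n T a₁ a₂ b₁ b₂ (lam T) (η T)) →
          Tendsto (fun T =>
            Setup.avgGradSq (Ω := Ω) (Ξ := Ξ)
              { R := R, C := C, g := g, ξ := ξ, x₀ := x₀, η := η T, lam := lam T } μ f πR T)
            atTop (𝓝 0)) := by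
  have hn : 0 < n := by
    obtain ⟨r, -⟩ := hnet.exists_root
    exact Fin.pos r
  have hn' : (0 : ℝ) < n := by exact_mod_cast hn
  have hcp := cPi_pos hnet hπR hπC
  obtain ⟨c, hc, hpath⟩ :=
    exists_pathwise_gradient_bound hnet hπR hπC (abs_nonneg L) hb₂.le
  have hc0 : 0 < c := by linarith
  have hc2 : 1 ≤ c ^ 2 := one_le_pow₀ hc
  obtain ⟨K₁, hK₁⟩ : ∃ K₁, K₁ = (16 / cPi πR πC + 64 * c ^ 4 / κ) / (b₁ * a₁ ^ 2) := ⟨_, rfl⟩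
  obtain ⟨K₂, hK₂⟩ : ∃ K₂, K₂ = 48 * c ^ 4 * a₂ ^ 2 * n := ⟨_, rfl⟩
  have hK₁0 : 0 < K₁ := by rw [hK₁]; positivity
  have hK₂0 : 0 < K₂ := by rw [hK₂]; positivity
  -- Chosen so that `44 * c ^ 4 * lam ^ 2 ≤ 44 / 49`, as the pathwise bound requires.
  obtain ⟨lamMax, hlamMax⟩ : ∃ l : ℝ, l = 1 / (7 * c ^ 2) := ⟨_, rfl⟩
  have hlm0 : 0 < lamMax := by rw [hlamMax]; positivity
  have hlm1 : lamMax < 1 := by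
    rw [hlamMax, div_lt_one (by positivity)]; linarith
  refine ⟨lamMax, ⟨hlm0, hlm1⟩, K₁ + K₂, by positivity, ?_⟩
  intro d f hf₀ Ω Ξ _ _ μ _ D g σ ξ x₀ ho hs
  have hf : ObjectiveAssumption f |L| := hf₀.mono (le_abs_self L)
  -- A free number `p₂` stands for the third Lyapunov weight, so that the limit statement can choose
  -- it independently of `T`.
  have main : ∀ (T : ℕ) (lam η : ℝ), 1 ≤ T → lam ≤ lamMax → Coupled n T a₁ a₂ b₁ b₂ lam η →
      ∀ p₂ : ℝ, κ * η ≤ p₂ →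
      Setup.avgGradSq (Ω := Ω) (Ξ := Ξ)
        { R := R, C := C, g := g, ξ := ξ, x₀ := x₀, η := η, lam := lam } μ f πR T ≤
      (K₁ + K₂) * ((objective f x₀ - optValue f + p₂ * ∑ i, ‖gradient (f i) x₀‖ ^ 2)
        / √((n : ℝ) * T)) + (K₁ + K₂) * (σ ^ 2 * √((n : ℝ) / T)) := by
    intro T lam η hT hlm hcpl p₂ hp₂
    have hl := hcpl.lam_pos ha₁ hn hT
    have hT' : (0 : ℝ) < T := by exact_mod_cast hT
    have hr0 : 0 < √((n : ℝ) / T) := Real.sqrt_pos.2 (by positivity)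
    have hη := hcpl.le_step ha₁ hb₁
    have hη0 : 0 < η := lt_of_lt_of_le (by positivity) hη
    have hsmall : 44 * c ^ 4 * lam ^ 2 ≤ 1 := by
      calc 44 * c ^ 4 * lam ^ 2 ≤ 44 * c ^ 4 * (1 / (7 * c ^ 2)) ^ 2 := by
            rw [← hlamMax]; gcongr
        _ = 44 / 49 := by field_simp; norm_num
        _ ≤ 1 := by norm_num
    set A : Setup n d Ω Ξ :=
      { R := R, C := C, g := g, ξ := ξ, x₀ := x₀, η := η, lam := lam } with hA
    have hsum := Setup.sum_integral_le_of_pathwise (A := A) hf (abs_nonneg L) ho hs hπR.1 πC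
      (P := 4 / (cPi πR πC * η) * (objective f x₀ - optValue f)) (B := 48 * c ^ 4)
      (by positivity) T (fun ω => hpath lam η hl (hlm.trans hlm1.le) hsmall hη0 hcpl.2.2.2 d
        (fun i => gradient (f i)) x₀ _ _ _ _ (objective f) (optValue f) (A.isTrajectory f ω)
        hf.lipschitz (hf.descent (abs_nonneg L)) hf.optValue_le T)
    have hΔ : 0 ≤ objective f x₀ - optValue f := sub_nonneg.2 (hf.optValue_le x₀)
    have hG : 0 ≤ ∑ i, ‖gradient (f i) x₀‖ ^ 2 := Finset.sum_nonneg fun _ _ => sq_nonneg _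
    have havg := average_le_of_sum_le hT hn hκ (show 0 < b₁ * a₁ ^ 2 by positivity) hcp hη
      (hcpl.lam_sq_le hl) hΔ hG hp₂ hc hsum
    rw [← hK₁, ← hK₂] at havg
    have hp₂0 : 0 ≤ p₂ := le_trans (by positivity) hp₂
    simp only [Setup.avgGradSq, hf.gradient_eq]
    refine havg.trans ?_
    have t1 : 0 ≤ K₂ * ((objective f x₀ - optValue f + p₂ * ∑ i, ‖gradient (f i) x₀‖ ^ 2)
        / √((n : ℝ) * T)) := by positivity
    have t2 : 0 ≤ K₁ * (σ ^ 2 * √((n : ℝ) / T)) := by positivity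
    linarith
  refine ⟨fun T lam η hT hlm hcpl => ?_, fun lam η hcpl => ?_⟩
  · intro A
    have hl := hcpl.lam_pos ha₁ hn hT
    refine ⟨⟨hcpl.le_step ha₁ hb₁, hcpl.step_le hl hb₂⟩, fun k => ?_, fun SR SC p _ _ hp hpκ => ?_⟩
    · simp only [hf.gradient_eq]
      have h := Setup.memLp_gradient_xbar (A := A) hf (abs_nonneg L) ho hs πR k
      exact (memLp_two_iff_integrable_sq_norm h.1).1 h
    · have hV0 := A.lyapunov_zero (μ := μ) (f := f) hπR.1 πC SR SC p
      refine ⟨?_, A.lyapunov_nonneg hf πR πC SR SC hp T, hV0⟩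
      rw [hV0]
      exact main T lam η hT hlm hcpl (p 2) hpκ
  -- For `T ≥ 1` the coupling gives `η ≤ b₂ * a₂ ^ 2 * √n`, so this single weight is admissible for
  -- all large horizons and the numerator of the bound stays fixed.
  · set p₂ : ℝ := κ * (b₂ * a₂ ^ 2 * √n) with hp₂
    have hdiv : Tendsto (fun T : ℕ => (n : ℝ) / T) atTop (𝓝 0) :=
      tendsto_const_div_atTop_nhds_zero_nat _
    have hsq : Tendsto (fun T : ℕ => √((n : ℝ) / T)) atTop (𝓝 0) := by
      have h := (Real.continuous_sqrt.tendsto 0).comp hdiv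
      rwa [Real.sqrt_zero] at h
    have hsq' : Tendsto (fun T : ℕ => √((n : ℝ) * T)) atTop atTop :=
      Real.tendsto_sqrt_atTop.comp (tendsto_natCast_atTop_atTop.const_mul_atTop hn')
    have hquart : Tendsto (fun T : ℕ => a₂ * ((n : ℝ) / T) ^ (1 / 4 : ℝ)) atTop (𝓝 0) := by
      have h := (Real.continuousAt_rpow_const 0 (1 / 4 : ℝ) (Or.inr (by norm_num))).tendsto.comp hdiv
      have h' := h.const_mul a₂
      simpa [Real.zero_rpow] using h'
    have hbound : Tendsto (fun T : ℕ => (K₁ + K₂) *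
        ((objective f x₀ - optValue f + p₂ * ∑ i, ‖gradient (f i) x₀‖ ^ 2) / √((n : ℝ) * T))
        + (K₁ + K₂) * (σ ^ 2 * √((n : ℝ) / T))) atTop (𝓝 0) := by
      have h1 := (hsq'.const_div_atTop
        (objective f x₀ - optValue f + p₂ * ∑ i, ‖gradient (f i) x₀‖ ^ 2)).const_mul (K₁ + K₂)
      have h2 := (hsq.const_mul (σ ^ 2)).const_mul (K₁ + K₂)
      simpa using h1.add h2
    refine tendsto_of_tendsto_of_tendsto_of_le_of_le' tendsto_const_nhds hbound
      (Eventually.of_forall fun T => ?_) ?_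
    · exact mul_nonneg (by positivity)
        (Finset.sum_nonneg fun k _ => integral_nonneg fun ω => sq_nonneg _)
    · filter_upwards [hcpl, hquart.eventually (gt_mem_nhds hlm0), eventually_ge_atTop 1]
        with T hT hlT hT1
      have hl := hT.lam_pos ha₁ hn hT1
      refine main T (lam T) (η T) hT1 (hT.2.1.trans hlT.le) hT p₂ ?_
      rw [hp₂]
      have h1 : √((n : ℝ) / T) ≤ √n :=
        Real.sqrt_le_sqrt (div_le_self hn'.le (by exact_mod_cast hT1))
      have h2 := hT.step_le hl hb₂
      gcongr
      exact h2.trans (by gcongr)
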